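/- Let $\rho>0$, $\mu>0$, $\lambda\ge 0$, $\omega>0$ and $\ell>0$ be real constants. Set $\vartheta_{\rm S}=\sqrt{\mu/\rho}$, $\vartheta_{\rm P}=\sqrt{(2\mu+\lambda)/\rho}$, $k_{\rm S}=\omega/\vartheta_{\rm S}$, $k_{\rm P}=\omega/\vartheta_{\rm P}$ and $\kappa_{\rm S}=k_{\rm S}\ell$. Let $$ \boldsymbol G(y)=\frac{1}{4\pi\vartheta_{\rm S}^2}\left(\frac{e^{ik_{\rm S}|y|}}{|y|}\,\boldsymbol I+\frac{1}{k_{\rm S}^2}\nabla^2\left(\frac{e^{ik_{\rm S}|y|}}{|y|}-\frac{e^{ik_{\rm P}|y|}}{|y|}\right)\right),\qquad y\in\mathbb R^3\setminus\{0\}, $$ be the outgoing elastic Green's tensor, where $\nabla^2$ denotes the Hessian matrix. Let $B_\ell\subset\mathbb R^3$ be the ball of radius $\ell$ centred at the origin, and for $v:B_\ell\to\mathbb C^3$ write $\|v\|_{\rho,B_\ell}=\left(\int_{B_\ell}\rho|v|^2\right)^{1/2}$. Then for every $f\in L^2(\mathbb R^3;\mathbb C^3)$ supported in $B_\ell$ (that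 is, vanishing almost everywhere outside $B_\ell$), the convolution $u:=\boldsymbol G\star f$, with components $u_j=\sum_{l=1}^3 G_{jl}\star f_l$, is given by absolutely convergent integrals at every point of $\mathbb R^3$, belongs to $L^2(B_\ell;\mathbb C^3)$, and satisfies $$ \omega^2\|u\|_{\rho,B_\ell}\le(4+17\kappa_{\rm S})\,\|f\|_{\rho,B_\ell}. $$ In particular, the constant does not depend on $\lambda$. -/

import Mathlib

open MeasureTheory Metric

noncomputable section

namespace Elastodynamics

/-- Physical space `ℝ³` with its Euclidean norm. -/
abbrev R3 : Type := EuclideanSpace ℝ (Fin 3)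

/-- Complex vectors `ℂ³` with their Euclidean (Hermitian) norm. -/
abbrev C3 : Type := EuclideanSpace ℂ (Fin 3)

/-- Shear wavespeed `ϑ_S = √(μ / ρ)`. -/
def shearSpeed (ρ μ : ℝ) : ℝ := Real.sqrt (μ / ρ)

/-- Pressure wavespeed `ϑ_P = √((2 μ + lam) / ρ)`. -/
def pressureSpeed (ρ μ lam : ℝ) : ℝ := Real.sqrt ((2 * μ + lam) / ρ)

/-- Shear wavenumber `k_S = ω / ϑ_S`. -/
def shearWavenumber (ρ μ ω : ℝ) : ℝ := ω / shearSpeed ρ μ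

/-- Pressure wavenumber `k_P = ω / ϑ_P`. -/
def pressureWavenumber (ρ μ lam ω : ℝ) : ℝ := ω / pressureSpeed ρ μ lam

/-- The outgoing spherical wave `y ↦ exp (i k |y|) / |y|`. -/
def sphericalWave (k : ℝ) (y : R3) : ℂ :=
  Complex.exp (Complex.I * k * ‖y‖) / ‖y‖

/-- The partial derivative `∂_j φ`. -/
def partialDeriv (j : Fin 3) (φ : R3 → ℂ) (y : R3) : ℂ :=
  fderiv ℝ φ y (EuclideanSpace.single j 1)

/-- The Hessian matrix `(∂_j ∂_l φ)_{j l}`. -/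
def hessian (φ : R3 → ℂ) (y : R3) : Matrix (Fin 3) (Fin 3) ℂ :=
  Matrix.of fun j l => partialDeriv j (partialDeriv l φ) y

/-- The elastic Green's tensor. The scalar function under the Hessian is smooth away from the
origin, bounded and Lipschitz near it, and its classical Hessian is `O(1 / |y|)` there; so the
classical Hessian (off the null set `{0}`) is also the Hessian in the sense of distributions, and
the tensor is a locally square-integrable function. -/
def greenTensor (ρ μ lam ω : ℝ) (y : R3) : Matrix (Fin 3) (Fin 3) ℂ :=
  (1 / (4 * (Real.pi : ℂ) * (shearSpeed ρ μ : ℂ) ^ 2)) •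
    (sphericalWave (shearWavenumber ρ μ ω) y • (1 : Matrix (Fin 3) (Fin 3) ℂ) +
      (1 / (shearWavenumber ρ μ ω : ℂ) ^ 2) •
        hessian (fun z => sphericalWave (shearWavenumber ρ μ ω) z -
          sphericalWave (pressureWavenumber ρ μ lam ω) z) y)

/-- The convolution `K ⋆ f` of a matrix-valued kernel with a vector field:
`(K ⋆ f)_j = ∑_l K_{jl} ⋆ f_l`. -/
def tensorConvolution (K : R3 → Matrix (Fin 3) (Fin 3) ℂ) (f : R3 → C3) (x : R3) : C3 :=
  WithLp.toLp 2 fun j => ∑ l,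
    convolution (fun y => K y j l) (fun y => f y l) (ContinuousLinearMap.mul ℝ ℂ) volume x

/-- The integrals defining `K ⋆ f` converge absolutely at every point. -/
def TensorConvolutionExists (K : R3 → Matrix (Fin 3) (Fin 3) ℂ) (f : R3 → C3) : Prop :=
  ∀ j l, ConvolutionExists (fun y => K y j l) (fun y => f y l)
    (ContinuousLinearMap.mul ℝ ℂ) volume

/-- The weighted norm `‖v‖_{m,D} = (∫_D m |v|²)^{1/2}`. -/
def weightedNorm (m : R3 → ℝ) (D : Set R3) (v : R3 → C3) : ℝ :=
  Real.sqrt (∫ x in D, m x * ‖v x‖ ^ 2)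

end Elastodynamics

end

/-! The operator `f ↦ ω² G ⋆ f`, restricted to the ball `B_ℓ`, only sees the kernel on `|y| < 2 ℓ`.
There `ω² G` coincides with `truncatedTensor R k p` for `R = 2 ℓ`, `k = k_S`, `p = k_P`, in which
each spherical wave `exp(i k |y|) / |y|` is multiplied by a smooth radial cutoff `χ` equal to `1` up
to `R` and to `0` beyond `2 R`. This kernel is `O(1 / |y|)` with compact support, hence integrable and
square-integrable, and Plancherel's theorem bounds the convolution by the supremum of its symbol
(`integral_norm_sq_tensorConvolution_le`).

The cutoff stands inside the Hessian, so the Hessian becomes multiplication by `-s² e eᵀ`, where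
`s = 2 π |ξ|` and `e = ξ / |ξ|`; the singularity at the origin contributes nothing
(`fourier_lineDeriv`). The Fourier transform of a truncated wave is `4 π A_k(s)`, where
`A_k(s) = s⁻¹ ∫ χ(r) exp(i k r) sin(s r) dr` (`fourier_radial_div`). Thus the symbol has the
eigenvalue `k² A_k` on the complement of `e` and the eigenvalue `k² A_k - s² (A_k - A_p)` along `e`.

One integration by parts gives the resolvent identity `(s² - k²) A_k = 1 - E_k`, where `E_k` involves
`χ'` only (`sq_sub_sq_mul_helmholtzSymbol`) and `|E_k| ≤ 2 R k + 1`. Together with the trivial bound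
`|A_k| ≤ 2 R / s` this yields `k² |A_k| ≤ 8 / 3 + 4 R k`. Along `e` the identities for `k` and `p`
turn the eigenvalue into `E_k - E_p + p² A_p`, and `|E_k - E_p| ≤ 4 R k` because the parts of `E`
without a wavenumber almost cancel. Both eigenvalues are therefore at most
`8 / 3 + 8 R k = 8 / 3 + 16 κ_S` with `κ_S = k_S ℓ`, and the parameter `λ` enters only through `k_P ≤ k_S`. -/

noncomputable section

namespace Elastodynamics

section Kernel

open scoped FourierTransform ContDiff SchwartzMap

/-! ### Plancherel's theorem and convolution with a matrix kernel -/

section Plancherel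

variable {E F : Type*} [NormedAddCommGroup E] [InnerProductSpace ℝ E] [FiniteDimensional ℝ E]
  [MeasurableSpace E] [BorelSpace E] [NormedAddCommGroup F] [InnerProductSpace ℂ F]
  [CompleteSpace F]

theorem integral_smul_fourier_eq_of_integrable {f : E → F} (hf : Integrable f) (g : 𝓢(E, ℂ)) :
    ∫ ξ, g ξ • 𝓕 f ξ = ∫ x, (𝓕 g) x • f x := by
  have h := VectorFourier.integral_fourierIntegral_smul_eq_flip (L := innerₗ E)
    (μ := volume) (ν := volume) Real.continuous_fourierChar continuous_inner
    (g.integrable (μ := volume)) hf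
  rw [SchwartzMap.fourier_coe]
  rw [flip_innerₗ] at h
  exact h.symm

/-- On `L¹ ∩ L²` the Fourier transform given by the integral agrees with the one obtained by
extending the Schwartz-space transform to `L²`: both have the same pairing with test functions. -/
theorem fourier_toLp_ae_eq {f : E → F} (hf : Integrable f) (hf2 : MemLp f 2) :
    (𝓕 (hf2.toLp f) : Lp F 2 (volume : Measure E)) =ᵐ[volume] 𝓕 f := by
  have hcont : Continuous (𝓕 f) :=
    VectorFourier.fourierIntegral_continuous Real.continuous_fourierChar continuous_inner hf
  apply ae_eq_of_integral_contDiff_smul_eq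
    ((Lp.memLp (μ := volume)
      (𝓕 (hf2.toLp f) : Lp F 2 (volume : Measure E))).locallyIntegrable (by norm_num))
    hcont.locallyIntegrable
  intro g g_smooth g_cpt
  have hg₁ : HasCompactSupport (Complex.ofRealCLM ∘ g) := g_cpt.comp_left rfl
  have hg₂ : ContDiff ℝ ∞ (Complex.ofRealCLM ∘ g) := by fun_prop
  set G : 𝓢(E, ℂ) := hg₁.toSchwartzMap hg₂ with hG
  have hGg : ∀ x, G x = (g x : ℂ) := fun x => rfl
  have h1 := DFunLike.congr_fun (Lp.fourier_toTemperedDistribution_eq (hf2.toLp f)) G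
  rw [TemperedDistribution.fourier_apply, Lp.toTemperedDistribution_apply,
    Lp.toTemperedDistribution_apply] at h1
  calc ∫ x, g x • (𝓕 (hf2.toLp f) : Lp F 2 (volume : Measure E)) x
      = ∫ x, G x • (𝓕 (hf2.toLp f) : Lp F 2 (volume : Measure E)) x := by simp [hGg]
    _ = ∫ x, (𝓕 G) x • (hf2.toLp f) x := h1.symm
    _ = ∫ x, (𝓕 G) x • f x := by
        refine integral_congr_ae ?_
        filter_upwards [hf2.coeFn_toLp] with x hx
        rw [hx]
    _ = ∫ x, G x • 𝓕 f x := (integral_smul_fourier_eq_of_integrable hf G).symm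
    _ = _ := by simp [hGg]

theorem memLp_two_fourier {f : E → F} (hf : Integrable f) (hf2 : MemLp f 2) :
    MemLp (𝓕 f) 2 :=
  (memLp_congr_ae (fourier_toLp_ae_eq hf hf2)).1 (Lp.memLp _)

omit [CompleteSpace F] in
theorem integral_norm_sq_eq_norm_toLp {f : E → F} (hf2 : MemLp f 2) :
    ∫ x, ‖f x‖ ^ 2 = ‖hf2.toLp f‖ ^ 2 := by
  rw [← Complex.ofReal_inj]
  have := L2.inner_def (𝕜 := ℂ) (hf2.toLp f) (hf2.toLp f)
  rw [inner_self_eq_norm_sq_to_K] at this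
  push_cast
  refine Eq.trans ?_ this.symm
  rw [← integral_complex_ofReal]
  refine integral_congr_ae ?_
  filter_upwards [hf2.coeFn_toLp] with x hx
  rw [hx, inner_self_eq_norm_sq_to_K]
  simp

/-- Plancherel's theorem for `L¹ ∩ L²`, with the Fourier transform given by the integral. -/
theorem integral_norm_sq_fourier_eq {f : E → F} (hf : Integrable f) (hf2 : MemLp f 2) :
    ∫ ξ, ‖𝓕 f ξ‖ ^ 2 = ∫ x, ‖f x‖ ^ 2 := by
  rw [integral_norm_sq_eq_norm_toLp hf2, ← Lp.norm_fourier_eq (hf2.toLp f),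
    integral_norm_sq_eq_norm_toLp (memLp_two_fourier hf hf2)]
  congr 2
  apply Lp.ext
  exact (MemLp.coeFn_toLp _).trans (fourier_toLp_ae_eq hf hf2).symm

end Plancherel

theorem memLp_two_of_integrable_of_bounded {α F : Type*} [MeasurableSpace α] {μ : Measure α}
    [NormedAddCommGroup F] {f : α → F} (hf : Integrable f μ) {C : ℝ} (hC : ∀ x, ‖f x‖ ≤ C) :
    MemLp f 2 μ := by
  rw [memLp_two_iff_integrable_sq_norm hf.aestronglyMeasurable]
  refine Integrable.mono' (hf.norm.const_mul C) (by fun_prop) ?_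
  filter_upwards with x
  rw [Real.norm_of_nonneg (by positivity), pow_two]
  exact mul_le_mul_of_nonneg_right (hC x) (norm_nonneg _)

theorem norm_convolution_le_of_memLp_two {k g : R3 → ℂ} (hk : MemLp k 2) (hg : MemLp g 2)
    (x : R3) :
    ‖convolution k g (ContinuousLinearMap.mul ℝ ℂ) volume x‖ ≤
      (∫ y, ‖k y‖ ^ 2) + ∫ y, ‖g y‖ ^ 2 := by
  have hk2 := (memLp_two_iff_integrable_sq_norm hk.1).1 hk
  have hg2 := (memLp_two_iff_integrable_sq_norm hg.1).1 hg
  have hg2' : Integrable (fun y => ‖g (x - y)‖ ^ 2) := hg2.comp_sub_left x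
  rw [← integral_sub_left_eq_self (fun y => ‖g y‖ ^ 2) volume x, ← integral_add hk2 hg2']
  refine norm_integral_le_of_norm_le (hk2.add hg2') ?_
  filter_upwards with y
  simp only [ContinuousLinearMap.mul_apply', norm_mul]
  nlinarith [sq_nonneg (‖k y‖ - ‖g (x - y)‖), sq_nonneg (‖k y‖), sq_nonneg ‖g (x - y)‖]

theorem integrable_mul_convolution {k g : R3 → ℂ} (hk : Integrable k) (hg : Integrable g) :
    Integrable (convolution k g (ContinuousLinearMap.mul ℝ ℂ) volume) :=
  hk.integrable_convolution _ hg

theorem fourier_apply_component {f : R3 → C3} (hf : Integrable f) (ξ : R3) (j : Fin 3) :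
    𝓕 f ξ j = 𝓕 (fun x => f x j) ξ := by
  have h : Integrable (fun v => 𝐞 (-inner ℝ v ξ) • f v) := by
    simpa [Circle.smul_def] using (Real.fourierIntegral_convergent_iff ξ).2 hf
  rw [Real.fourier_eq, Real.fourier_eq]
  exact ((EuclideanSpace.proj (𝕜 := ℂ) j).integral_comp_comm h).symm

theorem fourier_tensorConvolution {K : R3 → Matrix (Fin 3) (Fin 3) ℂ} {f : R3 → C3}
    (hK : ∀ j l, Integrable fun y => K y j l) (hf : Integrable f)
    (hu : Integrable (tensorConvolution K f)) (ξ : R3) (j : Fin 3) :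
    𝓕 (tensorConvolution K f) ξ j = ∑ l, 𝓕 (fun y => K y j l) ξ * 𝓕 f ξ l := by
  have hfl : ∀ l, Integrable fun y => f y l := integrable_piLp_iff.1 hf
  rw [fourier_apply_component hu]
  have hc : ∀ l, Integrable
      (convolution (fun y => K y j l) (fun y => f y l) (ContinuousLinearMap.mul ℝ ℂ) volume) :=
    fun l => integrable_mul_convolution (hK j l) (hfl l)
  have : ∀ l, 𝓕 (convolution (fun y => K y j l) (fun y => f y l)
      (ContinuousLinearMap.mul ℝ ℂ) volume) ξ = 𝓕 (fun y => K y j l) ξ * 𝓕 f ξ l := by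
    intro l
    rw [fourier_apply_component hf]
    exact Real.fourier_mul_convolution_eq (hK j l) (hfl l) ξ
  simp_rw [← this, Real.fourier_eq, tensorConvolution, Finset.smul_sum]
  rw [integral_finsetSum]
  intro l _
  simpa [Circle.smul_def] using (Real.fourierIntegral_convergent_iff ξ).2 (hc l)

theorem integrable_tensorConvolution {K : R3 → Matrix (Fin 3) (Fin 3) ℂ} {f : R3 → C3}
    (hK : ∀ j l, Integrable fun y => K y j l) (hf : Integrable f) :
    Integrable (tensorConvolution K f) := by
  rw [integrable_piLp_iff]
  intro j
  simp only [tensorConvolution]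
  exact integrable_finsetSum _ fun l _ =>
    integrable_mul_convolution (hK j l) (integrable_piLp_iff.1 hf l)

/-- The convolution is integrable since both factors are, and bounded since both are
square-integrable; hence it is square-integrable. -/
theorem memLp_two_tensorConvolution {K : R3 → Matrix (Fin 3) (Fin 3) ℂ} {f : R3 → C3}
    (hK : ∀ j l, Integrable fun y => K y j l) (hK2 : ∀ j l, MemLp (fun y => K y j l) 2)
    (hf : Integrable f) (hf2 : MemLp f 2) : MemLp (tensorConvolution K f) 2 := by
  rw [memLp_piLp_iff]
  intro j
  simp only [tensorConvolution]
  refine memLp_finsetSum _ fun l _ => ?_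
  exact memLp_two_of_integrable_of_bounded
    (integrable_mul_convolution (hK j l) (integrable_piLp_iff.1 hf l))
    (norm_convolution_le_of_memLp_two (hK2 j l) (memLp_piLp_iff.1 hf2 l))

/-- Convolution with a matrix kernel is bounded on `L²` by the supremum of the operator norm of the
Fourier transform of the kernel. -/
theorem integral_norm_sq_tensorConvolution_le {K : R3 → Matrix (Fin 3) (Fin 3) ℂ} {f : R3 → C3}
    (hK : ∀ j l, Integrable fun y => K y j l) (hK2 : ∀ j l, MemLp (fun y => K y j l) 2)
    (hf : Integrable f) (hf2 : MemLp f 2) {M : ℝ}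
    (hM : ∀ᵐ ξ : R3, ∀ v : Fin 3 → ℂ,
      ∑ j, ‖∑ l, 𝓕 (fun y => K y j l) ξ * v l‖ ^ 2 ≤ M ^ 2 * ∑ l, ‖v l‖ ^ 2) :
    ∫ x, ‖tensorConvolution K f x‖ ^ 2 ≤ M ^ 2 * ∫ x, ‖f x‖ ^ 2 := by
  have hu := integrable_tensorConvolution hK hf
  have hu2 := memLp_two_tensorConvolution hK hK2 hf hf2
  rw [← integral_norm_sq_fourier_eq hu hu2, ← integral_norm_sq_fourier_eq hf hf2,
    ← integral_const_mul]
  have h1 := memLp_two_fourier hu hu2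
  have h2 := memLp_two_fourier hf hf2
  refine integral_mono_ae ((memLp_two_iff_integrable_sq_norm h1.1).1 h1)
    (((memLp_two_iff_integrable_sq_norm h2.1).1 h2).const_mul _) ?_
  filter_upwards [hM] with ξ hξ
  simpa only [EuclideanSpace.norm_sq_eq, fourier_tensorConvolution hK hf hu] using
    hξ (fun l => 𝓕 f ξ l)

/-! ### Fourier transform of derivatives of functions singular at the origin -/

/-- The point of `ℝ³` with `j`-th coordinate `p.1` and remaining coordinates `p.2`. -/
def lineParam (j : Fin 3) (p : ℝ × (Fin 2 → ℝ)) : R3 :=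
  WithLp.toLp 2 ((MeasurableEquiv.piFinSuccAbove (fun _ : Fin 3 => ℝ) j).symm p)

/-- `lineParam j` as a measurable equivalence. -/
def lineParamEquiv (j : Fin 3) : (ℝ × (Fin 2 → ℝ)) ≃ᵐ R3 :=
  (MeasurableEquiv.piFinSuccAbove (fun _ : Fin 3 => ℝ) j).symm.trans (MeasurableEquiv.toLp 2 _)

theorem measurePreserving_lineParam (j : Fin 3) :
    MeasurePreserving (lineParam j) (volume.prod volume) volume :=
  (PiLp.volume_preserving_toLp (Fin 3)).comp
    ((volume_preserving_piFinSuccAbove (fun _ : Fin 3 => ℝ) j).symm _)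

theorem measurableEmbedding_lineParam (j : Fin 3) : MeasurableEmbedding (lineParam j) :=
  (lineParamEquiv j).measurableEmbedding

theorem lineParam_add (j : Fin 3) (t s : ℝ) (y : Fin 2 → ℝ) :
    lineParam j (t + s, y) = lineParam j (t, y) + s • EuclideanSpace.single j (1 : ℝ) := by
  ext i
  simp only [lineParam, MeasurableEquiv.piFinSuccAbove_symm_apply, Fin.insertNthEquiv_apply,
    PiLp.add_apply, PiLp.smul_apply, PiLp.single_apply, smul_eq_mul]
  rcases eq_or_ne i j with rfl | h
  · simp
  · obtain ⟨k, rfl⟩ := Fin.exists_succAbove_eq h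
    simp

theorem lineParam_ne_zero (j : Fin 3) (t : ℝ) {y : Fin 2 → ℝ} (hy : y ≠ 0) :
    lineParam j (t, y) ≠ 0 := by
  intro h
  apply hy
  ext k
  have := congrArg (fun x : R3 => x (j.succAbove k)) h
  simpa [lineParam] using this

/-- The integral of a partial derivative vanishes even if the function is singular at the origin:
almost every line in direction `j` misses the origin, and on such a line the fundamental theorem of
calculus applies. -/
theorem integral_lineDeriv_eq_zero {φ φ' : R3 → ℂ} {j : Fin 3}
    (h : ∀ x, x ≠ 0 → HasLineDerivAt ℝ φ (φ' x) x (EuclideanSpace.single j 1))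
    (hφ : Integrable φ) (hφ' : Integrable φ') : ∫ x, φ' x = 0 := by
  have mp := measurePreserving_lineParam j
  have me := measurableEmbedding_lineParam j
  have i1 : Integrable (fun p => φ (lineParam j p)) (volume.prod volume) :=
    (mp.integrable_comp_emb me).2 hφ
  have i2 : Integrable (fun p => φ' (lineParam j p)) (volume.prod volume) :=
    (mp.integrable_comp_emb me).2 hφ'
  rw [← mp.integral_comp me, integral_prod_symm _ i2]
  refine integral_eq_zero_of_ae ?_
  -- The line with transversal coordinate `y` passes through the origin only for `y = 0`.
  have hne : ∀ᵐ y : Fin 2 → ℝ, y ≠ 0 := by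
    simp [ae_iff]
  filter_upwards [i1.prod_left_ae, i2.prod_left_ae, hne] with y h1 h2 hy
  refine integral_eq_zero_of_hasDerivAt_of_integrable (f := fun t => φ (lineParam j (t, y)))
    (fun t => ?_) h2 h1
  have := h _ (lineParam_ne_zero j t hy)
  rw [HasLineDerivAt] at this
  simp only [← lineParam_add] at this
  rw [← sub_self t] at this
  simpa using this.comp_sub_const t t

theorem hasLineDerivAt_fourierChar (ξ x : R3) (j : Fin 3) :
    HasLineDerivAt ℝ (fun v : R3 => (𝐞 (-inner ℝ v ξ) : ℂ))
      (-(2 * Real.pi * Complex.I * ξ j) * 𝐞 (-inner ℝ x ξ)) x (EuclideanSpace.single j 1) := by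
  have h : HasFDerivAt (fun v : R3 => (𝐞 (-inner ℝ v ξ) : ℂ)) _ x :=
    (Real.hasFDerivAt_fourierChar_neg_bilinear_left (innerSL ℝ) x ξ)
  have h2 := h.hasLineDerivAt (EuclideanSpace.single j 1)
  convert! h2 using 1
  have h3 : innerSL ℝ ξ (EuclideanSpace.single j 1) = ξ j := by
    change inner ℝ ξ (EuclideanSpace.single j 1) = ξ j
    simp [EuclideanSpace.inner_single_right]
  have h4 : innerSL ℝ x ξ = inner ℝ x ξ := rfl
  simp [-coe_innerSL_apply, h3, h4]
  ring

/-- The Fourier transform of a partial derivative, for functions differentiable off the origin. No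
delta distribution arises at the origin, because both functions are integrable and almost every line
in direction `j` misses the origin. -/
theorem fourier_lineDeriv {φ φ' : R3 → ℂ} {j : Fin 3}
    (h : ∀ x, x ≠ 0 → HasLineDerivAt ℝ φ (φ' x) x (EuclideanSpace.single j 1))
    (hφ : Integrable φ) (hφ' : Integrable φ') (ξ : R3) :
    𝓕 φ' ξ = 2 * Real.pi * Complex.I * ξ j * 𝓕 φ ξ := by
  have i1 : Integrable (fun v => (𝐞 (-inner ℝ v ξ) : ℂ) * φ v) := by
    simpa [Circle.smul_def] using (Real.fourierIntegral_convergent_iff ξ).2 hφ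
  have i2 : Integrable (fun v => (𝐞 (-inner ℝ v ξ) : ℂ) * φ' v) := by
    simpa [Circle.smul_def] using (Real.fourierIntegral_convergent_iff ξ).2 hφ'
  have key := integral_lineDeriv_eq_zero (j := j) (φ := fun v => (𝐞 (-inner ℝ v ξ) : ℂ) * φ v)
    (φ' := fun v => -(2 * Real.pi * Complex.I * ξ j) * ((𝐞 (-inner ℝ v ξ) : ℂ) * φ v) +
      (𝐞 (-inner ℝ v ξ) : ℂ) * φ' v) (fun x hx => ?_) i1 ((i1.const_mul _).add i2)
  · rw [integral_add (i1.const_mul _) i2, integral_const_mul] at key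
    rw [Real.fourier_eq, Real.fourier_eq]
    simp only [Circle.smul_def, smul_eq_mul]
    linear_combination key
  · have h1 := hasLineDerivAt_fourierChar ξ x j
    have h2 := h x hx
    have := HasDerivAt.mul h1 h2
    simp only [zero_smul, add_zero] at this
    rw [HasLineDerivAt]
    convert! this using 1
    ring

/-! ### Fourier transform of radial functions in three dimensions -/

theorem integrable_radial_div {g : ℝ → ℂ} {L : ℝ} (hg : Continuous g) (hL : ∀ r, L ≤ r → g r = 0) :
    Integrable (fun x : R3 => g ‖x‖ / ‖x‖) := by
  have h : IntegrableOn (fun y : ℝ => y * g y) (Set.Ioi 0) := by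
    have h0 : IntegrableOn (fun y : ℝ => y * g y) (Set.Icc 0 L) :=
      (by fun_prop : Continuous fun y : ℝ => y * g y).integrableOn_Icc
    refine h0.of_forall_sdiff_eq_zero measurableSet_Ioi fun y hy => ?_
    have : L ≤ y := by
      by_contra hlt
      exact hy.2 ⟨le_of_lt hy.1, le_of_lt (not_le.1 hlt)⟩
    simp [hL y this]
  refine (integrable_fun_norm_addHaar (volume : Measure R3) (f := fun r : ℝ => g r / r)).2 ?_
  refine h.congr_fun (fun y hy => ?_) measurableSet_Ioi
  have hy0 : (y : ℂ) ≠ 0 := Complex.ofReal_ne_zero.2 (ne_of_gt hy)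
  simp [pow_two]
  field_simp

/-- Every nonzero frequency can be rotated onto the first coordinate axis. -/
theorem exists_rotation {ξ : R3} (hξ : ξ ≠ 0) :
    ∃ T : R3 ≃ₗᵢ[ℝ] R3, ∀ x, inner ℝ x ξ = ‖ξ‖ * T x 0 := by
  have ho : Orthonormal ℝ (({0} : Set (Fin 3)).domRestrict
      (fun _ : Fin 3 => (‖ξ‖⁻¹ • ξ : R3))) := by
    constructor
    · intro i
      simp [norm_smul, norm_ne_zero_iff.2 hξ]
    · intro i j hij
      exact absurd (Subsingleton.elim i j) hij
  obtain ⟨b, hb⟩ := ho.exists_orthonormalBasis_extension_of_card_eq (by simp)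
  refine ⟨b.repr, fun x => ?_⟩
  have h0 := hb 0 rfl
  simp only [b.repr_apply_apply, h0, real_inner_smul_left, real_inner_comm x ξ]
  field_simp [norm_ne_zero_iff.2 hξ]

theorem integral_radial_fin_two (m : ℝ → ℂ) :
    ∫ y : Fin 2 → ℝ, m (y 0 ^ 2 + y 1 ^ 2) =
      2 * Real.pi * ∫ r in Set.Ioi (0 : ℝ), r * m (r ^ 2) := by
  have h1 : ∫ y : Fin 2 → ℝ, m (y 0 ^ 2 + y 1 ^ 2) =
      ∫ p : ℝ × ℝ, m (p.1 ^ 2 + p.2 ^ 2) :=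
    (volume_preserving_finTwoArrow ℝ).integral_comp
      MeasurableEquiv.finTwoArrow.measurableEmbedding (fun p : ℝ × ℝ => m (p.1 ^ 2 + p.2 ^ 2))
  rw [h1, ← integral_comp_polarCoord_symm]
  have h2 : ∀ p : ℝ × ℝ, (p.1 • m ((polarCoord.symm p).1 ^ 2 + (polarCoord.symm p).2 ^ 2)) =
      (p.1 * m (p.1 ^ 2)) * 1 := by
    intro p
    rw [polarCoord_symm_apply]
    have : (p.1 * Real.cos p.2) ^ 2 + (p.1 * Real.sin p.2) ^ 2 = p.1 ^ 2 := by
      linear_combination p.1 ^ 2 * Real.sin_sq_add_cos_sq p.2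
    simp only [this]
    simp
  simp_rw [h2]
  rw [polarCoord_target, Measure.volume_eq_prod, setIntegral_prod_mul
    (fun r : ℝ => (r : ℂ) * m (r ^ 2)) (fun _ => (1 : ℂ))]
  rw [setIntegral_const, mul_comm]
  congr 1
  simp [Measure.real]
  rw [ENNReal.toReal_ofReal (by positivity)]
  push_cast; ring

theorem norm_lineParam_zero (t : ℝ) (y : Fin 2 → ℝ) :
    ‖lineParam 0 (t, y)‖ = Real.sqrt (t ^ 2 + (y 0 ^ 2 + y 1 ^ 2)) := by
  rw [EuclideanSpace.norm_eq]
  have h0 : lineParam 0 (t, y) 0 = t := rfl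
  have h1 : lineParam 0 (t, y) 1 = y 0 := rfl
  have h2 : lineParam 0 (t, y) 2 = y 1 := rfl
  simp [Fin.sum_univ_three, h0, h1, h2, add_assoc]

/-- In the plane at height `t` the radius is `√(t² + r²)`, and the substitution of the radius as new
variable turns the polar integral into the tail integral of `g`. -/
theorem integral_mul_comp_sqrt {g : ℝ → ℂ} {L : ℝ} (hg : Continuous g)
    (hL : ∀ r, L ≤ r → g r = 0) {t : ℝ} (ht : t ≠ 0) :
    ∫ r in Set.Ioi (0 : ℝ), r * (g (Real.sqrt (t ^ 2 + r ^ 2)) / Real.sqrt (t ^ 2 + r ^ 2)) =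
      ∫ r in |t|..L, g r := by
  have hpos : ∀ r : ℝ, 0 < t ^ 2 + r ^ 2 := fun r => by positivity
  have hsq : ∀ r : ℝ, Real.sqrt (t ^ 2 + r ^ 2) ≠ 0 := fun r => (Real.sqrt_pos.2 (hpos r)).ne'
  have hge : ∀ r : ℝ, r ≤ Real.sqrt (t ^ 2 + r ^ 2) := fun r =>
    Real.le_sqrt_of_sq_le (by nlinarith [sq_nonneg t])
  have hcont : Continuous fun r : ℝ =>
      (r : ℂ) * (g (Real.sqrt (t ^ 2 + r ^ 2)) / Real.sqrt (t ^ 2 + r ^ 2)) := by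
    refine Continuous.mul (by fun_prop) (Continuous.div (by fun_prop) (by fun_prop) fun r => ?_)
    exact Complex.ofReal_ne_zero.2 (hsq r)
  have hint : IntegrableOn (fun r : ℝ =>
      (r : ℂ) * (g (Real.sqrt (t ^ 2 + r ^ 2)) / Real.sqrt (t ^ 2 + r ^ 2))) (Set.Ioi 0) := by
    refine (hcont.integrableOn_Icc (a := 0) (b := L)).of_forall_sdiff_eq_zero
      measurableSet_Ioi fun y hy => ?_
    have : L ≤ y := by
      by_contra hlt
      exact hy.2 ⟨le_of_lt hy.1, le_of_lt (not_le.1 hlt)⟩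
    simp [hL _ (this.trans (hge y))]
  have hd : ∀ r ∈ Set.Ici (0 : ℝ),
      HasDerivAt (fun r => ∫ u in |t|..Real.sqrt (t ^ 2 + r ^ 2), g u)
        ((r : ℂ) * (g (Real.sqrt (t ^ 2 + r ^ 2)) / Real.sqrt (t ^ 2 + r ^ 2))) r := by
    intro r _
    have h1 : HasDerivAt (fun r : ℝ => Real.sqrt (t ^ 2 + r ^ 2))
        ((2 * r) / (2 * Real.sqrt (t ^ 2 + r ^ 2))) r := by
      have := ((hasDerivAt_pow 2 r).const_add (t ^ 2)).sqrt (hpos r).ne'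
      simpa using this
    have h2 : HasDerivAt (fun u => ∫ v in |t|..u, g v) (g (Real.sqrt (t ^ 2 + r ^ 2)))
        (Real.sqrt (t ^ 2 + r ^ 2)) := hg.integral_hasStrictDerivAt _ _ |>.hasDerivAt
    have h3 := h2.scomp r h1
    convert! h3 using 1
    have := Complex.ofReal_ne_zero.2 (hsq r)
    simp only [Complex.real_smul]
    push_cast
    field_simp
  have htend : Filter.Tendsto (fun r => ∫ u in |t|..Real.sqrt (t ^ 2 + r ^ 2), g u) Filter.atTop
      (nhds (∫ u in |t|..L, g u)) := by
    refine tendsto_const_nhds.congr' ?_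
    filter_upwards [Filter.eventually_ge_atTop L] with r hr
    have h0 : ∫ u in L..Real.sqrt (t ^ 2 + r ^ 2), g u = 0 := by
      rw [intervalIntegral.integral_congr (g := fun _ => (0 : ℂ))]
      · simp
      · intro u hu
        rw [Set.uIcc_of_le (hr.trans (hge r))] at hu
        exact hL u hu.1
    have := intervalIntegral.integral_add_adjacent_intervals
      (hg.intervalIntegrable (μ := volume) |t| L)
      (hg.intervalIntegrable L (Real.sqrt (t ^ 2 + r ^ 2)))
    rwa [h0, add_zero] at this
  rw [integral_Ioi_of_hasDerivAt_of_tendsto' hd hint htend]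
  simp [Real.sqrt_sq_eq_abs]

/-- The one-dimensional Fourier integral of the even tail function `t ↦ ∫_{|t|}^L g` is a sine
integral of `g`, by an integration by parts. -/
theorem integral_cexp_mul_tail {g : ℝ → ℂ} {L s : ℝ} (hg : Continuous g)
    (hL0 : 0 < L) (hL : ∀ r, L ≤ r → g r = 0) (hs : s ≠ 0) :
    ∫ t : ℝ, Complex.exp (-(Complex.I * s * t)) * ∫ r in |t|..L, g r =
      2 / s * ∫ r in (0 : ℝ)..L, g r * Real.sin (s * r) := by
  have hP : Continuous fun t : ℝ => ∫ r in t..L, g r := by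
    have : (fun t : ℝ => ∫ r in t..L, g r) = fun t => - ∫ r in L..t, g r := by
      ext t; rw [intervalIntegral.integral_symm]
    rw [this]
    exact (intervalIntegral.continuous_primitive (fun a b => hg.intervalIntegrable a b) L).neg
  have hPabs : Continuous fun t : ℝ => ∫ r in |t|..L, g r := hP.comp continuous_abs
  have hz : ∀ t, L ≤ t → ∫ r in t..L, g r = 0 := by
    intro t ht
    rw [intervalIntegral.integral_congr (g := fun _ => (0 : ℂ))]
    · simp
    · intro u hu
      rw [Set.uIcc_of_ge ht] at hu
      exact hL u hu.1
  have hcont : Continuous fun t : ℝ =>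
      Complex.exp (-(Complex.I * s * t)) * ∫ r in |t|..L, g r := by fun_prop
  rw [← intervalIntegral.integral_eq_integral_of_support_subset (a := -L) (b := L)]
  swap
  · intro t ht
    have : |t| < L := by
      by_contra h
      exact ht (by simp [hz _ (not_lt.1 h)])
    exact ⟨(abs_lt.1 this).1, (abs_lt.1 this).2.le⟩
  rw [← intervalIntegral.integral_add_adjacent_intervals (b := 0)
    (hcont.intervalIntegrable _ _) (hcont.intervalIntegrable _ _)]
  have hneg : ∫ t in (-L)..0, Complex.exp (-(Complex.I * s * t)) * ∫ r in |t|..L, g r =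
      ∫ t in (0 : ℝ)..L, Complex.exp (Complex.I * s * t) * ∫ r in |t|..L, g r := by
    have := intervalIntegral.integral_comp_neg (a := 0) (b := L)
      (fun t : ℝ => Complex.exp (-(Complex.I * s * t)) * ∫ r in |t|..L, g r)
    rw [neg_zero] at this
    rw [← this]
    simp
  have hcont' : Continuous fun t : ℝ =>
      Complex.exp (Complex.I * s * t) * ∫ r in |t|..L, g r := by fun_prop
  rw [hneg, ← intervalIntegral.integral_add (hcont'.intervalIntegrable _ _)
    (hcont.intervalIntegrable _ _)]
  have hsC : (s : ℂ) ≠ 0 := Complex.ofReal_ne_zero.2 hs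
  have hcos : ∫ t in (0 : ℝ)..L, (Complex.exp (Complex.I * s * t) * (∫ r in |t|..L, g r) +
      Complex.exp (-(Complex.I * s * t)) * ∫ r in |t|..L, g r) =
      ∫ t in (0 : ℝ)..L, (∫ r in t..L, g r) * (2 * Real.cos (s * t)) := by
    refine intervalIntegral.integral_congr fun t ht => ?_
    rw [Set.uIcc_of_le hL0.le] at ht
    simp only [abs_of_nonneg ht.1]
    push_cast
    rw [Complex.two_cos]
    ring_nf
  rw [hcos]
  have hu : ∀ t ∈ Set.uIcc (0 : ℝ) L, HasDerivAt (fun t => ∫ r in t..L, g r) (-g t) t :=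
    fun t _ => intervalIntegral.integral_hasDerivAt_left (hg.intervalIntegrable _ _)
      (hg.stronglyMeasurableAtFilter _ _) hg.continuousAt
  have hv : ∀ t ∈ Set.uIcc (0 : ℝ) L,
      HasDerivAt (fun t : ℝ => ((2 / s * Real.sin (s * t) : ℝ) : ℂ))
        (2 * Real.cos (s * t)) t := by
    intro t _
    have h1 : HasDerivAt (fun t : ℝ => 2 / s * Real.sin (s * t)) (2 * Real.cos (s * t)) t := by
      have := (((hasDerivAt_id t).const_mul s).sin).const_mul (2 / s)
      convert! this using 1
      simp
      field_simp
    exact_mod_cast h1.ofReal_comp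
  rw [intervalIntegral.integral_mul_deriv_eq_deriv_mul hu hv
    (hg.neg.intervalIntegrable _ _) ((by fun_prop : Continuous fun t : ℝ =>
      (2 * (Real.cos (s * t) : ℂ))).intervalIntegrable _ _)]
  simp only [intervalIntegral.integral_same, mul_zero, Real.sin_zero, Complex.ofReal_zero,
    zero_mul, sub_zero, zero_sub]
  rw [← intervalIntegral.integral_neg, ← intervalIntegral.integral_const_mul]
  refine intervalIntegral.integral_congr fun t _ => ?_
  push_cast
  ring

/-- The Fourier transform of the radial function `g(|x|) / |x|` on `ℝ³` is `4 π / s` times the sine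
transform of `g` at the angular frequency `s = 2 π |ξ|`. The proof integrates first over the planes
orthogonal to `ξ`. -/
theorem fourier_radial_div {g : ℝ → ℂ} {L : ℝ} (hg : Continuous g)
    (hL0 : 0 < L) (hL : ∀ r, L ≤ r → g r = 0) {ξ : R3} (hξ : ξ ≠ 0) :
    𝓕 (fun x : R3 => g ‖x‖ / ‖x‖) ξ =
      4 * Real.pi / (2 * Real.pi * ‖ξ‖) *
        ∫ r in (0 : ℝ)..L, g r * Real.sin (2 * Real.pi * ‖ξ‖ * r) := by
  obtain ⟨T, hT⟩ := exists_rotation hξ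
  set s : ℝ := 2 * Real.pi * ‖ξ‖ with hs
  have hs0 : s ≠ 0 := by have := norm_ne_zero_iff.2 hξ; positivity
  have mp := measurePreserving_lineParam 0
  have me := measurableEmbedding_lineParam 0
  have hchar : ∀ x : R3, (𝐞 (-inner ℝ x ξ) : ℂ) = Complex.exp (-(Complex.I * s * (T x 0 : ℝ))) := by
    intro x
    rw [Real.fourierChar_apply, hT, hs]
    push_cast
    ring_nf
  have hint : Integrable (fun x : R3 =>
      Complex.exp (-(Complex.I * s * (x 0 : ℝ))) * (g ‖x‖ / ‖x‖)) := by
    refine (integrable_radial_div hg hL).bdd_mul (c := 1)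
      (by fun_prop) ?_
    filter_upwards with x
    rw [Complex.norm_exp]
    simp
  calc 𝓕 (fun x : R3 => g ‖x‖ / ‖x‖) ξ
      = ∫ x : R3, Complex.exp (-(Complex.I * s * (T x 0 : ℝ))) * (g ‖T x‖ / ‖T x‖) := by
        rw [Real.fourier_eq]
        simp only [Circle.smul_def, smul_eq_mul, hchar, LinearIsometryEquiv.norm_map]
    _ = ∫ x : R3, Complex.exp (-(Complex.I * s * (x 0 : ℝ))) * (g ‖x‖ / ‖x‖) :=
        T.measurePreserving.integral_comp T.toHomeomorph.measurableEmbedding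
          (fun x : R3 => Complex.exp (-(Complex.I * s * (x 0 : ℝ))) * (g ‖x‖ / ‖x‖))
    _ = ∫ t : ℝ, ∫ y : Fin 2 → ℝ, Complex.exp (-(Complex.I * s * (lineParam 0 (t, y) 0 : ℝ))) *
          (g ‖lineParam 0 (t, y)‖ / ‖lineParam 0 (t, y)‖) := by
        have hint' := (mp.integrable_comp_emb me).2 hint
        rw [← mp.integral_comp me]
        exact integral_prod _ hint'
    _ = ∫ t : ℝ, 2 * Real.pi * (Complex.exp (-(Complex.I * s * t)) * ∫ r in |t|..L, g r) := by
        refine integral_congr_ae ?_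
        have hne : ∀ᵐ t : ℝ, t ≠ 0 := by simp [ae_iff]
        filter_upwards [hne] with t ht
        have h0 : ∀ y : Fin 2 → ℝ, lineParam 0 (t, y) 0 = t := fun y => by simp [lineParam]
        simp only [h0, norm_lineParam_zero]
        rw [integral_const_mul, integral_radial_fin_two
          (fun q => g (Real.sqrt (t ^ 2 + q)) / Real.sqrt (t ^ 2 + q)),
          integral_mul_comp_sqrt hg hL ht]
        ring
    _ = _ := by
        rw [integral_const_mul, integral_cexp_mul_tail hg hL0 hL hs0, hs]
        push_cast
        ring

/-! ### Symbol of the truncated Helmholtz fundamental solution -/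

/-- A smooth decreasing cutoff on the half-line: it is `1` up to `R` and `0` beyond `2 R`. -/
def cutoff (R r : ℝ) : ℝ := Real.smoothTransition (2 - r / R)

section Cutoff

variable {R : ℝ}

theorem contDiff_cutoff (R : ℝ) : ContDiff ℝ ∞ (cutoff R) :=
  Real.smoothTransition.contDiff.comp (by fun_prop)

theorem differentiable_cutoff (R : ℝ) : Differentiable ℝ (cutoff R) :=
  (contDiff_cutoff R).differentiable (by simp)

theorem continuous_deriv_cutoff (R : ℝ) : Continuous (deriv (cutoff R)) :=
  (contDiff_cutoff R).continuous_deriv (by simp)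

theorem cutoff_eq_one (hR : 0 < R) {r : ℝ} (hr : r ≤ R) : cutoff R r = 1 := by
  apply Real.smoothTransition.one_of_one_le
  have := (div_le_one hR).2 hr
  linarith

theorem cutoff_eq_zero (hR : 0 < R) {r : ℝ} (hr : 2 * R ≤ r) : cutoff R r = 0 := by
  apply Real.smoothTransition.zero_of_nonpos
  have := (le_div_iff₀ hR).2 hr
  linarith

theorem abs_cutoff_le_one (R r : ℝ) : |cutoff R r| ≤ 1 := by
  rw [cutoff, abs_of_nonneg (Real.smoothTransition.nonneg _)]
  exact Real.smoothTransition.le_one _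

theorem antitone_cutoff (hR : 0 < R) : Antitone (cutoff R) := fun a b hab =>
  Real.smoothTransition.monotone (by gcongr)

/-- The cutoff decreases from `1` to `0`, so its derivative has total mass one. -/
theorem norm_integral_deriv_cutoff_mul_le (hR : 0 < R) {F : ℝ → ℂ} {C : ℝ}
    (hF : ∀ r ∈ Set.Icc 0 (2 * R), ‖F r‖ ≤ C) :
    ‖∫ r in (0 : ℝ)..(2 * R), ((deriv (cutoff R) r : ℝ) : ℂ) * F r‖ ≤ C := by
  have h2 : (0 : ℝ) ≤ 2 * R := by positivity
  have hint : ∫ r in (0 : ℝ)..(2 * R), -deriv (cutoff R) r * C = C := by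
    rw [intervalIntegral.integral_mul_const, intervalIntegral.integral_neg,
      intervalIntegral.integral_deriv_eq_sub (fun x _ => differentiable_cutoff R x)
        ((continuous_deriv_cutoff R).intervalIntegrable _ _),
      cutoff_eq_one hR hR.le, cutoff_eq_zero hR le_rfl]
    ring
  rw [← hint]
  refine intervalIntegral.norm_integral_le_of_norm_le h2 ?_
    (((continuous_deriv_cutoff R).neg.mul continuous_const).intervalIntegrable _ _)
  refine Filter.Eventually.of_forall fun r hr => ?_
  rw [norm_mul, Complex.norm_real, Real.norm_eq_abs,
    abs_of_nonpos ((antitone_cutoff hR).deriv_nonpos)]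
  exact mul_le_mul_of_nonneg_left (hF r ⟨hr.1.le, hr.2⟩)
    (neg_nonneg.2 (antitone_cutoff hR).deriv_nonpos)

end Cutoff

/-- The symbol `s⁻¹ ∫ χ(r) exp(i k r) sin(s r) dr` at angular frequency `s` of the truncated
Helmholtz fundamental solution `χ(|x|) exp(i k |x|) / (4 π |x|)`. -/
def helmholtzSymbol (R k s : ℝ) : ℂ :=
  1 / s * ∫ r in (0 : ℝ)..(2 * R),
    cutoff R r * Complex.exp (Complex.I * k * r) * Real.sin (s * r)

/-- `s⁻¹` times the antiderivative of `(s² - k²) exp(i k r) sin(s r)`. -/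
def resonantPrimitive (k s r : ℝ) : ℂ :=
  Complex.exp (Complex.I * k * r) *
    (Complex.I * k * (Real.sin (s * r) / s : ℝ) - (Real.cos (s * r) : ℝ))

/-- The symbol of the commutator of the Helmholtz operator with the cutoff, applied to the
fundamental solution. It is written after an integration by parts, so that only the first
derivative of the cutoff occurs. -/
def commutatorSymbol (R k s : ℝ) : ℂ :=
  ∫ r in (0 : ℝ)..(2 * R), ((deriv (cutoff R) r : ℝ) : ℂ) * resonantPrimitive k s r

theorem norm_exp_I_mul_mul (k r : ℝ) : ‖Complex.exp (Complex.I * k * r)‖ = 1 := by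
  rw [Complex.norm_exp]
  simp

theorem continuous_resonantPrimitive (k s : ℝ) : Continuous (resonantPrimitive k s) := by
  unfold resonantPrimitive
  fun_prop

theorem abs_sin_mul_div_le {s r : ℝ} (hs : 0 < s) (hr : 0 ≤ r) : |Real.sin (s * r) / s| ≤ r := by
  rw [abs_div, abs_of_pos hs, div_le_iff₀ hs]
  refine (Real.abs_sin_le_abs).trans ?_
  rw [abs_of_nonneg (by positivity), mul_comm]

theorem norm_resonantPrimitive_le {k s r : ℝ} (hk : 0 ≤ k) (hs : 0 < s) (hr : 0 ≤ r) :
    ‖resonantPrimitive k s r‖ ≤ k * r + 1 := by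
  rw [resonantPrimitive, norm_mul, norm_exp_I_mul_mul, one_mul]
  refine (norm_sub_le _ _).trans (add_le_add ?_ ?_)
  · rw [norm_mul, norm_mul, Complex.norm_I, one_mul, Complex.norm_real, Complex.norm_real,
      Real.norm_of_nonneg hk]
    exact mul_le_mul_of_nonneg_left (abs_sin_mul_div_le hs hr) hk
  · rw [Complex.norm_real]
    exact Real.abs_cos_le_one _

theorem norm_exp_sub_exp_le (k p r : ℝ) :
    ‖Complex.exp (Complex.I * k * r) - Complex.exp (Complex.I * p * r)‖ ≤ |(k - p) * r| := by
  have h : Complex.exp (Complex.I * k * r) - Complex.exp (Complex.I * p * r) =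
      Complex.exp (Complex.I * p * r) * (Complex.exp (Complex.I * ((k - p) * r : ℝ)) - 1) := by
    rw [mul_sub, ← Complex.exp_add, mul_one]
    push_cast
    ring_nf
  rw [h, norm_mul, norm_exp_I_mul_mul, one_mul]
  exact Real.norm_exp_I_mul_ofReal_sub_one_le

theorem norm_resonantPrimitive_sub_le {k p s r : ℝ} (hp : 0 ≤ p) (hpk : p ≤ k) (hs : 0 < s)
    (hr : 0 ≤ r) : ‖resonantPrimitive k s r - resonantPrimitive p s r‖ ≤ 2 * k * r := by
  have hk : 0 ≤ k := hp.trans hpk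
  have hterm : ∀ q : ℝ, 0 ≤ q → ‖Complex.exp (Complex.I * q * r) *
      (Complex.I * q * (Real.sin (s * r) / s : ℝ))‖ ≤ q * r := by
    intro q hq
    rw [norm_mul, norm_exp_I_mul_mul, one_mul, norm_mul, norm_mul, Complex.norm_I, one_mul,
      Complex.norm_real, Complex.norm_real, Real.norm_of_nonneg hq]
    exact mul_le_mul_of_nonneg_left (abs_sin_mul_div_le hs hr) hq
  have hcos : ‖(Complex.exp (Complex.I * k * r) - Complex.exp (Complex.I * p * r)) *
      (Real.cos (s * r) : ℝ)‖ ≤ (k - p) * r := by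
    have h1 := norm_exp_sub_exp_le k p r
    rw [abs_of_nonneg (mul_nonneg (sub_nonneg.2 hpk) hr)] at h1
    rw [norm_mul, Complex.norm_real]
    exact (mul_le_of_le_one_right (norm_nonneg _) (Real.abs_cos_le_one _)).trans h1
  have e : resonantPrimitive k s r - resonantPrimitive p s r =
      Complex.exp (Complex.I * k * r) * (Complex.I * k * (Real.sin (s * r) / s : ℝ)) -
      Complex.exp (Complex.I * p * r) * (Complex.I * p * (Real.sin (s * r) / s : ℝ)) -
      (Complex.exp (Complex.I * k * r) - Complex.exp (Complex.I * p * r)) *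
        (Real.cos (s * r) : ℝ) := by
    rw [resonantPrimitive, resonantPrimitive]
    ring
  rw [e]
  calc _ ≤ k * r + p * r + (k - p) * r :=
        (norm_sub_le _ _).trans (add_le_add ((norm_sub_le _ _).trans
          (add_le_add (hterm k hk) (hterm p hp))) hcos)
    _ = 2 * k * r := by ring

theorem norm_commutatorSymbol_le {R k s : ℝ} (hR : 0 < R) (hk : 0 ≤ k) (hs : 0 < s) :
    ‖commutatorSymbol R k s‖ ≤ 2 * R * k + 1 := by
  refine norm_integral_deriv_cutoff_mul_le hR fun r hr => ?_
  refine (norm_resonantPrimitive_le hk hs hr.1).trans ?_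
  nlinarith [mul_le_mul_of_nonneg_left hr.2 hk]

/-- In the difference of two commutator symbols the terms without a wavenumber cancel to first order,
since `|exp(i k r) - exp(i p r)| ≤ |k - p| r`; no additive constant remains. -/
theorem norm_commutatorSymbol_sub_le {R k p s : ℝ} (hR : 0 < R) (hp : 0 ≤ p) (hpk : p ≤ k)
    (hs : 0 < s) : ‖commutatorSymbol R k s - commutatorSymbol R p s‖ ≤ 4 * R * k := by
  have hi : ∀ q : ℝ, IntervalIntegrable
      (fun r => ((deriv (cutoff R) r : ℝ) : ℂ) * resonantPrimitive q s r) volume 0 (2 * R) := fun q =>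
    ((Complex.continuous_ofReal.comp (continuous_deriv_cutoff R)).mul
      (continuous_resonantPrimitive q s)).intervalIntegrable _ _
  rw [commutatorSymbol, commutatorSymbol, ← intervalIntegral.integral_sub (hi k) (hi p)]
  simp_rw [← mul_sub]
  refine norm_integral_deriv_cutoff_mul_le hR fun r hr => ?_
  refine (norm_resonantPrimitive_sub_le hp hpk hs hr.1).trans ?_
  nlinarith [mul_le_mul_of_nonneg_left hr.2 (hp.trans hpk)]

theorem hasDerivAt_resonantPrimitive (k r : ℝ) {s : ℝ} (hs : s ≠ 0) :
    HasDerivAt (resonantPrimitive k s)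
      ((s ^ 2 - k ^ 2) * (1 / s * (Complex.exp (Complex.I * k * r) * Real.sin (s * r)))) r := by
  have hsC : (s : ℂ) ≠ 0 := Complex.ofReal_ne_zero.2 hs
  have h1 : HasDerivAt (fun r : ℝ => Complex.exp (Complex.I * k * r))
      (Complex.exp (Complex.I * k * r) * (Complex.I * k)) r := by
    have : HasDerivAt (fun r : ℝ => Complex.I * k * (r : ℂ)) (Complex.I * k) r := by
      simpa using (Complex.ofRealCLM.hasDerivAt (x := r)).const_mul (Complex.I * k)
    exact this.cexp
  have h2 : HasDerivAt (fun r : ℝ => ((Real.sin (s * r) / s : ℝ) : ℂ)) (Real.cos (s * r) : ℝ) r := by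
    refine HasDerivAt.ofReal_comp ?_
    have := (((hasDerivAt_id r).const_mul s).sin).div_const s
    convert! this using 1
    simp
    field_simp
  have h3 : HasDerivAt (fun r : ℝ => ((Real.cos (s * r) : ℝ) : ℂ))
      ((-(Real.sin (s * r) * s) : ℝ) : ℂ) r := by
    refine HasDerivAt.ofReal_comp ?_
    have := ((hasDerivAt_id r).const_mul s).cos
    convert! this using 1
    simp
  have h := h1.mul ((h2.const_mul (Complex.I * k)).sub h3)
  convert! h using 1
  simp only [Pi.sub_apply]
  push_cast
  field_simp
  ring_nf
  rw [Complex.I_sq]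
  ring

/-- The resolvent identity for the truncated wave: `(-Δ - k²)` maps the truncated fundamental
solution to the delta distribution minus a function supported where the cutoff varies, whose symbol
is `commutatorSymbol`. -/
theorem sq_sub_sq_mul_helmholtzSymbol {R : ℝ} (hR : 0 < R) (k : ℝ) {s : ℝ} (hs : s ≠ 0) :
    (s ^ 2 - k ^ 2) * helmholtzSymbol R k s = 1 - commutatorSymbol R k s := by
  have h := intervalIntegral.integral_mul_deriv_eq_deriv_mul (a := 0) (b := 2 * R)
    (u := fun r => (cutoff R r : ℂ)) (u' := fun r => ((deriv (cutoff R) r : ℝ) : ℂ))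
    (v := resonantPrimitive k s)
    (fun r _ => ((differentiable_cutoff R r).hasDerivAt).ofReal_comp)
    (fun r _ => hasDerivAt_resonantPrimitive k r hs)
    ((Complex.continuous_ofReal.comp (continuous_deriv_cutoff R)).intervalIntegrable _ _)
    ((by fun_prop : Continuous fun r : ℝ => ((s : ℂ) ^ 2 - k ^ 2) *
      (1 / s * (Complex.exp (Complex.I * k * r) * Real.sin (s * r)))).intervalIntegrable _ _)
  rw [cutoff_eq_zero hR le_rfl, cutoff_eq_one hR hR.le] at h
  have h0 : resonantPrimitive k s 0 = -1 := by simp [resonantPrimitive]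
  rw [h0, ← commutatorSymbol] at h
  rw [helmholtzSymbol, ← mul_assoc, ← intervalIntegral.integral_const_mul]
  refine Eq.trans (intervalIntegral.integral_congr fun r _ => ?_) (h.trans ?_)
  · ring
  · simp

theorem norm_helmholtzSymbol_le {R : ℝ} (hR : 0 < R) (k : ℝ) {s : ℝ} (hs : 0 < s) :
    ‖helmholtzSymbol R k s‖ ≤ 2 * R / s := by
  rw [helmholtzSymbol, norm_mul, norm_div, norm_one, Complex.norm_real, Real.norm_of_nonneg hs.le,
    one_div, div_eq_inv_mul]
  refine mul_le_mul_of_nonneg_left ?_ (by positivity)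
  have := intervalIntegral.norm_integral_le_of_norm_le_const (a := 0) (b := 2 * R) (C := 1)
    (f := fun r : ℝ => (cutoff R r : ℂ) * Complex.exp (Complex.I * k * r) * Real.sin (s * r))
    (fun r _ => ?_)
  · simpa [abs_of_pos hR] using this
  · rw [norm_mul, norm_mul, norm_exp_I_mul_mul, mul_one, Complex.norm_real, Complex.norm_real]
    exact mul_le_one₀ (abs_cutoff_le_one R r) (norm_nonneg _) (Real.abs_sin_le_one _)

/-- Linear growth in `R k`. Frequencies `s ≥ k / 2` are controlled by the trivial bound
`2 R / s`, the lower ones by the resolvent identity, where `k² - s² ≥ 3 k² / 4`. -/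
theorem sq_mul_norm_helmholtzSymbol_le {R k s : ℝ} (hR : 0 < R) (hk : 0 < k) (hs : 0 < s) :
    k ^ 2 * ‖helmholtzSymbol R k s‖ ≤ 8 / 3 + 4 * R * k := by
  -- The threshold `k / 2` keeps the low frequencies away from the resonance `s = k`.
  rcases le_total (k / 2) s with h | h
  · have h1 : k ^ 2 * ‖helmholtzSymbol R k s‖ ≤ k ^ 2 * (2 * R / (k / 2)) := by
      refine mul_le_mul_of_nonneg_left ((norm_helmholtzSymbol_le hR k hs).trans ?_) (by positivity)
      gcongr
    have h2 : k ^ 2 * (2 * R / (k / 2)) = 4 * R * k := by field_simp; ring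
    linarith
  · have e := congrArg norm (sq_sub_sq_mul_helmholtzSymbol hR k hs.ne')
    have h1 : ‖(1 : ℂ) - commutatorSymbol R k s‖ ≤ 2 * R * k + 2 := by
      refine (norm_sub_le _ _).trans ?_
      have := norm_commutatorSymbol_le hR hk.le hs
      rw [norm_one]; linarith
    have h2 : ‖(s : ℂ) ^ 2 - k ^ 2‖ = k ^ 2 - s ^ 2 := by
      have : (s : ℂ) ^ 2 - k ^ 2 = ((s ^ 2 - k ^ 2 : ℝ) : ℂ) := by push_cast; rfl
      rw [this, Complex.norm_real, Real.norm_of_nonpos (by nlinarith)]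
      ring
    rw [norm_mul, h2] at e
    have h3 : 3 / 4 * k ^ 2 ≤ k ^ 2 - s ^ 2 := by nlinarith
    have h4 := mul_le_mul_of_nonneg_right h3 (norm_nonneg (helmholtzSymbol R k s))
    nlinarith [mul_pos hR hk]

/-- The left-hand side is the longitudinal eigenvalue of the symbol of the truncated elastic tensor.
By the resolvent identities for `k` and `p` the growing factor `s²` disappears from it. -/
theorem norm_longitudinal_symbol_le {R k p s : ℝ} (hR : 0 < R) (hp : 0 < p) (hpk : p ≤ k)
    (hs : 0 < s) :
    ‖(k : ℂ) ^ 2 * helmholtzSymbol R k s -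
      s ^ 2 * (helmholtzSymbol R k s - helmholtzSymbol R p s)‖ ≤ 8 / 3 + 8 * R * k := by
  have e : (k : ℂ) ^ 2 * helmholtzSymbol R k s -
      s ^ 2 * (helmholtzSymbol R k s - helmholtzSymbol R p s) =
      (commutatorSymbol R k s - commutatorSymbol R p s) + p ^ 2 * helmholtzSymbol R p s := by
    linear_combination sq_sub_sq_mul_helmholtzSymbol hR p hs.ne' -
      sq_sub_sq_mul_helmholtzSymbol hR k hs.ne'
  rw [e]
  have h1 := norm_commutatorSymbol_sub_le hR hp.le hpk hs
  have h2 := sq_mul_norm_helmholtzSymbol_le hR hp hs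
  have h3 : ‖(p : ℂ) ^ 2 * helmholtzSymbol R p s‖ = p ^ 2 * ‖helmholtzSymbol R p s‖ := by
    rw [norm_mul, norm_pow, Complex.norm_real, Real.norm_of_nonneg hp.le]
  refine (norm_add_le _ _).trans ?_
  rw [h3]
  nlinarith [mul_le_mul_of_nonneg_left hpk hR.le]

/-! ### Singularities of order `1 / |x|` and Hessians of radial functions -/

section Singular

theorem integrable_radial_indicator (L C : ℝ) :
    Integrable (fun x : R3 => (Set.Iic L).indicator (fun r => C / r) ‖x‖) := by
  refine (integrable_fun_norm_addHaar (volume : Measure R3)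
    (f := (Set.Iic L).indicator fun r => C / r)).2 ?_
  have h0 : IntegrableOn (fun y : ℝ => y * C) (Set.Icc 0 L) :=
    (by fun_prop : Continuous fun y : ℝ => y * C).integrableOn_Icc
  have h1 : IntegrableOn ((Set.Iic L).indicator fun y : ℝ => y * C) (Set.Ioi 0) := by
    rw [IntegrableOn, integrable_indicator_iff measurableSet_Iic, IntegrableOn,
      Measure.restrict_restrict measurableSet_Iic]
    exact h0.mono_set fun y hy => ⟨le_of_lt hy.2, hy.1⟩
  refine h1.congr_fun (fun y hy => ?_) measurableSet_Ioi
  have hy0 : y ≠ 0 := ne_of_gt hy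
  by_cases hyL : y ∈ Set.Iic L
  · simp [Set.indicator_of_mem hyL]
    field_simp
  · simp [Set.indicator_of_notMem hyL]

theorem integrable_radial_indicator_sq (L C : ℝ) :
    Integrable (fun x : R3 => (Set.Iic L).indicator (fun r => (C / r) ^ 2) ‖x‖) := by
  refine (integrable_fun_norm_addHaar (volume : Measure R3)
    (f := (Set.Iic L).indicator fun r => (C / r) ^ 2)).2 ?_
  have h0 : IntegrableOn (fun _ : ℝ => C ^ 2) (Set.Icc 0 L) :=
    continuous_const.integrableOn_Icc
  have h1 : IntegrableOn ((Set.Iic L).indicator fun _ : ℝ => C ^ 2) (Set.Ioi 0) := by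
    rw [IntegrableOn, integrable_indicator_iff measurableSet_Iic, IntegrableOn,
      Measure.restrict_restrict measurableSet_Iic]
    exact h0.mono_set fun y hy => ⟨le_of_lt hy.2, hy.1⟩
  refine h1.congr_fun (fun y hy => ?_) measurableSet_Ioi
  have hy0 : y ≠ 0 := ne_of_gt hy
  by_cases hyL : y ∈ Set.Iic L
  · simp [Set.indicator_of_mem hyL]
    field_simp
  · simp [Set.indicator_of_notMem hyL]

variable {φ : R3 → ℂ} {L C : ℝ}

theorem aestronglyMeasurable_of_continuousOn_ne_zero (hc : ContinuousOn φ {0}ᶜ) :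
    AEStronglyMeasurable φ volume := by
  have := hc.aestronglyMeasurable (μ := volume) (measurableSet_singleton (0 : R3)).compl
  have h : ∀ᵐ x : R3, x ∈ ({0}ᶜ : Set R3) := compl_mem_ae_iff.2 (measure_singleton _)
  rwa [Measure.restrict_eq_self_of_ae_mem h] at this

/-- In dimension three a singularity of order `1 / |x|` is integrable. -/
theorem integrable_of_norm_le_div_norm (hc : ContinuousOn φ {0}ᶜ)
    (h0 : ∀ x, L < ‖x‖ → φ x = 0) (hb : ∀ x, x ≠ 0 → ‖x‖ ≤ L → ‖φ x‖ ≤ C / ‖x‖) :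
    Integrable φ := by
  refine (integrable_radial_indicator L C).mono'
    (aestronglyMeasurable_of_continuousOn_ne_zero hc) ?_
  have hne : ∀ᵐ x : R3, x ≠ 0 := by simp [ae_iff]
  filter_upwards [hne] with x hx
  by_cases hxL : ‖x‖ ≤ L
  · rw [Set.indicator_of_mem (Set.mem_Iic.2 hxL)]
    exact hb x hx hxL
  · rw [Set.indicator_of_notMem (by simpa using hxL), h0 x (not_le.1 hxL), norm_zero]

/-- In dimension three a singularity of order `1 / |x|` is square-integrable. -/
theorem memLp_two_of_norm_le_div_norm (hc : ContinuousOn φ {0}ᶜ)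
    (h0 : ∀ x, L < ‖x‖ → φ x = 0) (hb : ∀ x, x ≠ 0 → ‖x‖ ≤ L → ‖φ x‖ ≤ C / ‖x‖) :
    MemLp φ 2 := by
  have hm := aestronglyMeasurable_of_continuousOn_ne_zero hc
  rw [memLp_two_iff_integrable_sq_norm hm]
  refine (integrable_radial_indicator_sq L C).mono' (by fun_prop) ?_
  have hne : ∀ᵐ x : R3, x ≠ 0 := by simp [ae_iff]
  filter_upwards [hne] with x hx
  rw [Real.norm_of_nonneg (by positivity)]
  by_cases hxL : ‖x‖ ≤ L
  · rw [Set.indicator_of_mem (Set.mem_Iic.2 hxL)]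
    exact pow_le_pow_left₀ (norm_nonneg _) (hb x hx hxL) 2
  · rw [Set.indicator_of_notMem (by simpa using hxL), h0 x (not_le.1 hxL)]
    simp

end Singular

section RadialDerivatives

theorem hasFDerivAt_norm_R3 {x : R3} (hx : x ≠ 0) :
    HasFDerivAt (fun y : R3 => ‖y‖) (‖x‖⁻¹ • innerSL ℝ x) x := by
  have hx0 : ‖x‖ ≠ 0 := norm_ne_zero_iff.2 hx
  have h := (hasStrictFDerivAt_norm_sq x).hasFDerivAt.sqrt (pow_ne_zero 2 hx0)
  simp only [Real.sqrt_sq (norm_nonneg _)] at h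
  convert! h using 1
  ext v
  simp
  field_simp

theorem innerSL_apply_single (x : R3) (j : Fin 3) :
    innerSL ℝ x (EuclideanSpace.single j 1) = x j := by
  change inner ℝ x (EuclideanSpace.single j 1) = x j
  simp [EuclideanSpace.inner_single_right]

theorem hasFDerivAt_radial {h : ℝ → ℂ} {h' : ℂ} {x : R3} (hx : x ≠ 0)
    (hh : HasDerivAt h h' ‖x‖) :
    HasFDerivAt (fun y : R3 => h ‖y‖) ((‖x‖⁻¹ • innerSL ℝ x).smulRight h') x :=
  (hh.hasFDerivAt.comp x (hasFDerivAt_norm_R3 hx)).congr_fderiv (by ext; simp [mul_assoc])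

theorem partialDeriv_eq_of_hasFDerivAt {φ : R3 → ℂ} {φ' : R3 →L[ℝ] ℂ} {x : R3}
    (h : HasFDerivAt φ φ' x) (j : Fin 3) :
    partialDeriv j φ x = φ' (EuclideanSpace.single j 1) := by
  rw [partialDeriv, h.fderiv]

variable {g g' g'' : ℝ → ℂ}

theorem hasDerivAt_div_self (hg : ∀ r, HasDerivAt g (g' r) r) {r : ℝ} (hr : r ≠ 0) :
    HasDerivAt (fun r : ℝ => g r / r) ((r * g' r - g r) / r ^ 2) r := by
  have h := (hg r).div (Complex.ofRealCLM.hasDerivAt (x := r)) (Complex.ofReal_ne_zero.2 hr)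
  convert! h using 1
  simp
  ring

theorem hasDerivAt_radial_coefficient (hg : ∀ r, HasDerivAt g (g' r) r)
    (hg' : ∀ r, HasDerivAt g' (g'' r) r) {r : ℝ} (hr : r ≠ 0) :
    HasDerivAt (fun r : ℝ => (r * g' r - g r) / r ^ 3)
      ((r ^ 2 * g'' r - 3 * (r * g' r - g r)) / r ^ 4) r := by
  have hrC := Complex.ofReal_ne_zero.2 hr
  have h1 := (((Complex.ofRealCLM.hasDerivAt (x := r)).mul (hg' r)).sub (hg r))
  have h2 : HasDerivAt (fun r : ℝ => (r : ℂ) ^ 3) (3 * r ^ 2) r := by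
    have := (hasDerivAt_pow 3 r).ofReal_comp
    convert! this using 1 <;> simp
  have h := h1.div h2 (pow_ne_zero 3 hrC)
  convert! h using 1
  simp
  field_simp

theorem hasFDerivAt_radial_div (hg : ∀ r, HasDerivAt g (g' r) r) {x : R3} (hx : x ≠ 0) :
    HasFDerivAt (fun y : R3 => g ‖y‖ / ‖y‖)
      ((‖x‖⁻¹ • innerSL ℝ x).smulRight ((‖x‖ * g' ‖x‖ - g ‖x‖) / (‖x‖ : ℂ) ^ 2)) x :=
  hasFDerivAt_radial hx (hasDerivAt_div_self hg (norm_ne_zero_iff.2 hx))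

theorem partialDeriv_radial_div (hg : ∀ r, HasDerivAt g (g' r) r) {x : R3} (hx : x ≠ 0)
    (l : Fin 3) :
    partialDeriv l (fun y : R3 => g ‖y‖ / ‖y‖) x =
      x l * ((‖x‖ * g' ‖x‖ - g ‖x‖) / (‖x‖ : ℂ) ^ 3) := by
  have hx0 : (‖x‖ : ℂ) ≠ 0 := Complex.ofReal_ne_zero.2 (norm_ne_zero_iff.2 hx)
  rw [partialDeriv_eq_of_hasFDerivAt (hasFDerivAt_radial_div hg hx),
    ContinuousLinearMap.smulRight_apply, smul_apply, innerSL_apply_single]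
  simp
  field_simp

theorem hasFDerivAt_partialDeriv_radial_div (hg : ∀ r, HasDerivAt g (g' r) r)
    (hg' : ∀ r, HasDerivAt g' (g'' r) r) {x : R3} (hx : x ≠ 0) (l : Fin 3) :
    HasFDerivAt (partialDeriv l (fun y : R3 => g ‖y‖ / ‖y‖))
      ((x l : ℂ) • (‖x‖⁻¹ • innerSL ℝ x).smulRight
          ((‖x‖ ^ 2 * g'' ‖x‖ - 3 * (‖x‖ * g' ‖x‖ - g ‖x‖)) / (‖x‖ : ℂ) ^ 4) +
        ((‖x‖ * g' ‖x‖ - g ‖x‖) / (‖x‖ : ℂ) ^ 3) •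
          (Complex.ofRealCLM ∘L (EuclideanSpace.proj (𝕜 := ℝ) l))) x := by
  have h1 := hasFDerivAt_radial hx
    (hasDerivAt_radial_coefficient hg hg' (norm_ne_zero_iff.2 hx))
  have h2 : HasFDerivAt (fun y : R3 => ((y l : ℝ) : ℂ))
      (Complex.ofRealCLM ∘L (EuclideanSpace.proj (𝕜 := ℝ) l)) x :=
    (Complex.ofRealCLM ∘L (EuclideanSpace.proj (𝕜 := ℝ) l) : R3 →L[ℝ] ℂ).hasFDerivAt
  refine (h2.mul h1).congr_of_eventuallyEq ?_
  filter_upwards [isOpen_compl_singleton.mem_nhds hx] with y hy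
  exact partialDeriv_radial_div hg hy l

theorem hessian_radial_div (hg : ∀ r, HasDerivAt g (g' r) r)
    (hg' : ∀ r, HasDerivAt g' (g'' r) r) {x : R3} (hx : x ≠ 0) (j l : Fin 3) :
    hessian (fun y : R3 => g ‖y‖ / ‖y‖) x j l =
      x l * (x j / ‖x‖ * ((‖x‖ ^ 2 * g'' ‖x‖ - 3 * (‖x‖ * g' ‖x‖ - g ‖x‖)) / (‖x‖ : ℂ) ^ 4)) +
        (‖x‖ * g' ‖x‖ - g ‖x‖) / (‖x‖ : ℂ) ^ 3 * (if l = j then 1 else 0) := by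
  rw [hessian, Matrix.of_apply,
    partialDeriv_eq_of_hasFDerivAt (hasFDerivAt_partialDeriv_radial_div hg hg' hx l)]
  rw [add_apply, smul_apply,
    ContinuousLinearMap.smulRight_apply, smul_apply, innerSL_apply_single]
  have hx0 : (‖x‖ : ℂ) ≠ 0 := Complex.ofReal_ne_zero.2 (norm_ne_zero_iff.2 hx)
  split_ifs with hlj <;> simp [hlj] <;> field_simp <;> simp

/-- The function `r g' - g` vanishes at `0` and has derivative `r g''`, hence is of order `r²`. -/
theorem norm_mul_deriv_sub_le (hg : ∀ r, HasDerivAt g (g' r) r)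
    (hg' : ∀ r, HasDerivAt g' (g'' r) r) (h0 : g 0 = 0) {L C : ℝ}
    (hC : ∀ r ∈ Set.Icc 0 L, ‖g'' r‖ ≤ C) {r : ℝ} (hr : r ∈ Set.Icc 0 L) :
    ‖r * g' r - g r‖ ≤ C * r ^ 2 := by
  have hd : ∀ t ∈ Set.Icc 0 r,
      HasDerivWithinAt (fun t : ℝ => t * g' t - g t) (t * g'' t) (Set.Icc 0 r) t := by
    intro t _
    have h1 := (((Complex.ofRealCLM.hasDerivAt (x := t)).mul (hg' t)).sub (hg t))
    refine HasDerivAt.hasDerivWithinAt ?_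
    convert! h1 using 1
    simp
  have hb : ∀ t ∈ Set.Icc 0 r, ‖(t : ℂ) * g'' t‖ ≤ r * C := by
    intro t ht
    rw [norm_mul, Complex.norm_real, Real.norm_of_nonneg ht.1]
    exact mul_le_mul ht.2 (hC t ⟨ht.1, ht.2.trans hr.2⟩) (norm_nonneg _) hr.1
  have := (convex_Icc 0 r).norm_image_sub_le_of_norm_hasDerivWithin_le hd hb
    (Set.left_mem_Icc.2 hr.1) (Set.right_mem_Icc.2 hr.1)
  simp only [h0, Complex.ofReal_zero, zero_mul, sub_zero, Real.norm_of_nonneg hr.1] at this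
  linarith

theorem abs_coord_le_norm (x : R3) (j : Fin 3) : ‖((x j : ℝ) : ℂ)‖ ≤ ‖x‖ := by
  rw [Complex.norm_real]
  exact PiLp.norm_apply_le x j

theorem norm_partialDeriv_radial_div_le (hg : ∀ r, HasDerivAt g (g' r) r)
    (hg' : ∀ r, HasDerivAt g' (g'' r) r) (h0 : g 0 = 0) {L C : ℝ}
    (hC : ∀ r ∈ Set.Icc 0 L, ‖g'' r‖ ≤ C) (l : Fin 3) {x : R3} (hx : x ≠ 0) (hxL : ‖x‖ ≤ L) :
    ‖partialDeriv l (fun y : R3 => g ‖y‖ / ‖y‖) x‖ ≤ C * L / ‖x‖ := by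
  have hpos : 0 < ‖x‖ := norm_pos_iff.2 hx
  have hC0 : 0 ≤ C := (norm_nonneg _).trans (hC _ ⟨hpos.le, hxL⟩)
  rw [partialDeriv_radial_div hg hx, norm_mul, norm_div, norm_pow,
    Complex.norm_real ‖x‖, Real.norm_of_nonneg hpos.le]
  have h1 := norm_mul_deriv_sub_le hg hg' h0 hC ⟨hpos.le, hxL⟩
  calc _ ≤ ‖x‖ * (C * ‖x‖ ^ 2 / ‖x‖ ^ 3) := by
        gcongr
        exact abs_coord_le_norm x l
    _ = C * ‖x‖ / ‖x‖ := by field_simp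
    _ ≤ _ := by gcongr

/-- If `g 0 = 0`, then `g(|x|) / |x|` is Lipschitz at the origin and its Hessian is of order
`1 / |x|`. -/
theorem norm_hessian_radial_div_le (hg : ∀ r, HasDerivAt g (g' r) r)
    (hg' : ∀ r, HasDerivAt g' (g'' r) r) (h0 : g 0 = 0) {L C : ℝ}
    (hC : ∀ r ∈ Set.Icc 0 L, ‖g'' r‖ ≤ C) (j l : Fin 3) {x : R3} (hx : x ≠ 0) (hxL : ‖x‖ ≤ L) :
    ‖hessian (fun y : R3 => g ‖y‖ / ‖y‖) x j l‖ ≤ 5 * C / ‖x‖ := by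
  have hpos : 0 < ‖x‖ := norm_pos_iff.2 hx
  have h1 := norm_mul_deriv_sub_le hg hg' h0 hC ⟨hpos.le, hxL⟩
  have h2 : ‖(‖x‖ : ℂ) ^ 2 * g'' ‖x‖ - 3 * (‖x‖ * g' ‖x‖ - g ‖x‖)‖ ≤ 4 * C * ‖x‖ ^ 2 := by
    refine (norm_sub_le _ _).trans ?_
    have h3 := hC ‖x‖ ⟨hpos.le, hxL⟩
    have h4 := mul_le_mul_of_nonneg_left h3 (sq_nonneg ‖x‖)
    rw [norm_mul, norm_mul, norm_pow, Complex.norm_real, Real.norm_of_nonneg hpos.le,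
      Complex.norm_ofNat]
    linarith
  have h5 : ‖(if l = j then 1 else 0 : ℂ)‖ ≤ 1 := by split_ifs <;> simp
  rw [hessian_radial_div hg hg' hx]
  refine (norm_add_le _ _).trans ?_
  rw [norm_mul, norm_mul, norm_div, norm_div, norm_mul, norm_div, norm_pow, norm_pow,
    Complex.norm_real ‖x‖, Real.norm_of_nonneg hpos.le]
  calc _ ≤ ‖x‖ * (‖x‖ / ‖x‖ * (4 * C * ‖x‖ ^ 2 / ‖x‖ ^ 4)) + C * ‖x‖ ^ 2 / ‖x‖ ^ 3 * 1 := by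
        have hC0 : 0 ≤ C := (norm_nonneg _).trans (hC _ ⟨hpos.le, hxL⟩)
        gcongr
        · exact abs_coord_le_norm x l
        · exact abs_coord_le_norm x j
    _ = 5 * C / ‖x‖ := by field_simp; ring

theorem continuousOn_partialDeriv_radial_div (hg : ∀ r, HasDerivAt g (g' r) r)
    (hg' : ∀ r, HasDerivAt g' (g'' r) r) (l : Fin 3) :
    ContinuousOn (partialDeriv l (fun y : R3 => g ‖y‖ / ‖y‖)) {0}ᶜ := fun _ hx =>
  (hasFDerivAt_partialDeriv_radial_div hg hg' hx l).continuousAt.continuousWithinAt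

theorem continuousOn_hessian_radial_div (hg : ∀ r, HasDerivAt g (g' r) r)
    (hg' : ∀ r, HasDerivAt g' (g'' r) r) (hc : Continuous g'') (j l : Fin 3) :
    ContinuousOn (fun x => hessian (fun y : R3 => g ‖y‖ / ‖y‖) x j l) {0}ᶜ := by
  have c0 : Continuous g := continuous_iff_continuousAt.2 fun r => (hg r).continuousAt
  have c1 : Continuous g' := continuous_iff_continuousAt.2 fun r => (hg' r).continuousAt
  refine ContinuousOn.congr ?_ fun x hx => hessian_radial_div hg hg' hx j l
  have hne : ∀ x : R3, x ∈ ({0}ᶜ : Set R3) → (‖x‖ : ℂ) ≠ 0 := fun x hx =>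
    Complex.ofReal_ne_zero.2 (norm_ne_zero_iff.2 hx)
  refine ContinuousOn.add ?_ ?_
  · refine ContinuousOn.mul (by fun_prop) (ContinuousOn.mul ?_ ?_)
    · exact ContinuousOn.div (by fun_prop) (by fun_prop) hne
    · exact ContinuousOn.div (by fun_prop) (by fun_prop) fun x hx => pow_ne_zero _ (hne x hx)
  · refine ContinuousOn.mul ?_ continuousOn_const
    exact ContinuousOn.div (by fun_prop) (by fun_prop) fun x hx => pow_ne_zero _ (hne x hx)

theorem partialDeriv_eq_zero_of_eventually {φ : R3 → ℂ} {x : R3} (h : φ =ᶠ[nhds x] 0)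
    (j : Fin 3) : partialDeriv j φ x = 0 := by
  rw [partialDeriv, h.fderiv_eq]
  simp

theorem partialDeriv_eq_zero_of_lt {φ : R3 → ℂ} {L : ℝ} (h : ∀ x, L < ‖x‖ → φ x = 0)
    (j : Fin 3) (x : R3) (hx : L < ‖x‖) : partialDeriv j φ x = 0 := by
  refine partialDeriv_eq_zero_of_eventually ?_ j
  filter_upwards [(isOpen_lt continuous_const continuous_norm).mem_nhds hx] with y hy
  exact h y hy

end RadialDerivatives

/-! ### The truncated elastic tensor and its symbol -/

/-- The profile `r ↦ χ(r) exp(i k r)` of a truncated spherical wave. -/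
def waveProfile (R k r : ℝ) : ℂ := cutoff R r * Complex.exp (Complex.I * k * r)

/-- The truncated outgoing spherical wave `χ(|y|) exp(i k |y|) / |y|`. -/
def truncatedWave (R k : ℝ) (y : R3) : ℂ := waveProfile R k ‖y‖ / ‖y‖

/-- The truncation of `ω²` times the Green's tensor with shear wavenumber `k` and pressure
wavenumber `p`. The cutoff is applied inside the Hessian, so that on the Fourier side the Hessian
remains a multiplication. -/
def truncatedTensor (R k p : ℝ) (y : R3) : Matrix (Fin 3) (Fin 3) ℂ :=
  (1 / (4 * (Real.pi : ℂ))) •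
    (((k : ℂ) ^ 2 * truncatedWave R k y) • (1 : Matrix (Fin 3) (Fin 3) ℂ) +
      hessian (fun z => truncatedWave R k z - truncatedWave R p z) y)

theorem contDiff_waveProfile (R k : ℝ) : ContDiff ℝ ∞ (waveProfile R k) := by
  have h1 : ContDiff ℝ ∞ fun r => (cutoff R r : ℂ) :=
    Complex.ofRealCLM.contDiff.comp (contDiff_cutoff R)
  have h2 : ContDiff ℝ ∞ fun r : ℝ => (r : ℂ) := Complex.ofRealCLM.contDiff
  exact h1.mul (contDiff_const.mul h2).cexp

theorem waveProfile_eq_zero {R : ℝ} (hR : 0 < R) (k : ℝ) {r : ℝ} (hr : 2 * R ≤ r) :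
    waveProfile R k r = 0 := by
  simp [waveProfile, cutoff_eq_zero hR hr]

theorem norm_waveProfile_le (R k r : ℝ) : ‖waveProfile R k r‖ ≤ 1 := by
  rw [waveProfile, norm_mul, norm_exp_I_mul_mul, mul_one, Complex.norm_real]
  exact abs_cutoff_le_one R r

theorem waveProfile_zero {R : ℝ} (hR : 0 < R) (k : ℝ) : waveProfile R k 0 = 1 := by
  simp [waveProfile, cutoff_eq_one hR hR.le]

theorem truncatedWave_eq_sphericalWave {R : ℝ} (hR : 0 < R) (k : ℝ) {y : R3} (hy : ‖y‖ ≤ R) :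
    truncatedWave R k y = sphericalWave k y := by
  simp [truncatedWave, waveProfile, sphericalWave, cutoff_eq_one hR hy]

theorem integrable_truncatedWave {R : ℝ} (hR : 0 < R) (k : ℝ) : Integrable (truncatedWave R k) :=
  integrable_radial_div (contDiff_waveProfile R k).continuous fun _ => waveProfile_eq_zero hR k

theorem memLp_two_truncatedWave {R : ℝ} (hR : 0 < R) (k : ℝ) : MemLp (truncatedWave R k) 2 := by
  refine memLp_two_of_norm_le_div_norm (L := 2 * R) (C := 1) ?_ (fun x hx => ?_) fun x _ _ => ?_
  · exact ContinuousOn.div ((contDiff_waveProfile R k).continuous.comp continuous_norm).continuousOn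
      (by fun_prop) fun x hx => Complex.ofReal_ne_zero.2 (norm_ne_zero_iff.2 hx)
  · simp [truncatedWave, waveProfile_eq_zero hR k hx.le]
  · rw [truncatedWave, norm_div, Complex.norm_real, norm_norm]
    gcongr
    exact norm_waveProfile_le R k _

theorem fourier_truncatedWave {R : ℝ} (hR : 0 < R) (k : ℝ) {ξ : R3} (hξ : ξ ≠ 0) :
    𝓕 (truncatedWave R k) ξ = 4 * Real.pi * helmholtzSymbol R k (2 * Real.pi * ‖ξ‖) := by
  have h := fourier_radial_div (L := 2 * R) (contDiff_waveProfile R k).continuous (by positivity)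
    (fun _ => waveProfile_eq_zero hR k) hξ
  refine Eq.trans h ?_
  rw [helmholtzSymbol]
  simp only [waveProfile]
  push_cast
  ring

section Difference

variable {R : ℝ} (k p : ℝ)

theorem truncatedWave_sub_eq (R k p : ℝ) :
    (fun z => truncatedWave R k z - truncatedWave R p z) =
      fun z : R3 => (fun r => waveProfile R k r - waveProfile R p r) ‖z‖ / ‖z‖ := by
  ext z
  simp only [truncatedWave]
  ring

theorem exists_derivs_waveProfile_sub (R k p : ℝ) : ∃ g' g'' : ℝ → ℂ,
    (∀ r, HasDerivAt (fun r => waveProfile R k r - waveProfile R p r) (g' r) r) ∧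
    (∀ r, HasDerivAt g' (g'' r) r) ∧ Continuous g'' := by
  have hg : ContDiff ℝ 2 (fun r => waveProfile R k r - waveProfile R p r) :=
    contDiff_infty.1 ((contDiff_waveProfile R k).sub (contDiff_waveProfile R p)) 2
  have hg' : ContDiff ℝ 1 (deriv fun r => waveProfile R k r - waveProfile R p r) :=
    ((contDiff_succ_iff_deriv (n := 1)).1 hg).2.2
  exact ⟨_, _, fun r => (hg.differentiable (by norm_num) r).hasDerivAt,
    fun r => (hg'.differentiable (by norm_num) r).hasDerivAt, hg'.continuous_deriv le_rfl⟩

theorem truncatedWave_sub_eq_zero (hR : 0 < R) (x : R3) (hx : 2 * R < ‖x‖) :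
    truncatedWave R k x - truncatedWave R p x = 0 := by
  simp [truncatedWave, waveProfile_eq_zero hR _ hx.le]

theorem integrable_partialDeriv_truncatedWave_sub (hR : 0 < R) (l : Fin 3) :
    Integrable (partialDeriv l fun z => truncatedWave R k z - truncatedWave R p z) := by
  obtain ⟨g', g'', hg, hg', hc⟩ := exists_derivs_waveProfile_sub R k p
  obtain ⟨C, hC⟩ := (isCompact_Icc (a := (0 : ℝ)) (b := 2 * R)).exists_bound_of_continuousOn
    hc.continuousOn
  have h0 := partialDeriv_eq_zero_of_lt (truncatedWave_sub_eq_zero k p hR) l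
  rw [truncatedWave_sub_eq] at h0 ⊢
  exact integrable_of_norm_le_div_norm (continuousOn_partialDeriv_radial_div hg hg' l) h0
    fun x hx hxL => norm_partialDeriv_radial_div_le hg hg'
      (by simp [waveProfile_zero hR]) hC l hx hxL

theorem hessian_truncatedWave_sub_regular (hR : 0 < R) (j l : Fin 3) :
    Integrable (fun x => hessian (fun z => truncatedWave R k z - truncatedWave R p z) x j l) ∧
    MemLp (fun x => hessian (fun z => truncatedWave R k z - truncatedWave R p z) x j l) 2 := by
  obtain ⟨g', g'', hg, hg', hc⟩ := exists_derivs_waveProfile_sub R k p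
  obtain ⟨C, hC⟩ := (isCompact_Icc (a := (0 : ℝ)) (b := 2 * R)).exists_bound_of_continuousOn
    hc.continuousOn
  have h0 : ∀ x : R3, 2 * R < ‖x‖ →
      hessian (fun z => truncatedWave R k z - truncatedWave R p z) x j l = 0 := fun x hx =>
    partialDeriv_eq_zero_of_lt
      (partialDeriv_eq_zero_of_lt (truncatedWave_sub_eq_zero k p hR) l) j x hx
  rw [truncatedWave_sub_eq] at h0 ⊢
  have hcont := continuousOn_hessian_radial_div hg hg' hc j l
  have hb := fun (x : R3) (hx : x ≠ 0) (hxL : ‖x‖ ≤ 2 * R) =>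
    norm_hessian_radial_div_le hg hg' (by simp [waveProfile_zero hR]) hC j l hx hxL
  exact ⟨integrable_of_norm_le_div_norm hcont h0 hb, memLp_two_of_norm_le_div_norm hcont h0 hb⟩

theorem fourier_hessian_truncatedWave_sub (hR : 0 < R) (j l : Fin 3) (ξ : R3) :
    𝓕 (fun x => hessian (fun z => truncatedWave R k z - truncatedWave R p z) x j l) ξ =
      2 * Real.pi * Complex.I * ξ j * (2 * Real.pi * Complex.I * ξ l *
        𝓕 (fun z => truncatedWave R k z - truncatedWave R p z) ξ) := by
  obtain ⟨g', g'', hg, hg', hc⟩ := exists_derivs_waveProfile_sub R k p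
  have i1 := integrable_partialDeriv_truncatedWave_sub k p hR l
  have i2 := (hessian_truncatedWave_sub_regular k p hR j l).1
  have i0 := (integrable_truncatedWave hR k).sub (integrable_truncatedWave hR p)
  have h1 := fourier_lineDeriv (φ := fun z => truncatedWave R k z - truncatedWave R p z) (j := l)
    (φ' := partialDeriv l fun z => truncatedWave R k z - truncatedWave R p z) (fun x hx => ?_) i0 i1 ξ
  · have h2 := fourier_lineDeriv (j := j)
      (φ := partialDeriv l fun z => truncatedWave R k z - truncatedWave R p z)
      (φ' := fun x => hessian (fun z => truncatedWave R k z - truncatedWave R p z) x j l)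
      (fun x hx => ?_) i1 i2 ξ
    · rw [h2, h1]
    · rw [truncatedWave_sub_eq]
      have hd := (hasFDerivAt_partialDeriv_radial_div hg hg' hx l).differentiableAt
      exact hd.hasFDerivAt.hasLineDerivAt _
  · rw [truncatedWave_sub_eq]
    exact (hasFDerivAt_radial_div hg hx).differentiableAt.hasFDerivAt.hasLineDerivAt _

end Difference

theorem truncatedTensor_apply (R k p : ℝ) (y : R3) (j l : Fin 3) :
    truncatedTensor R k p y j l = 1 / (4 * (Real.pi : ℂ)) *
      ((k : ℂ) ^ 2 * (1 : Matrix (Fin 3) (Fin 3) ℂ) j l * truncatedWave R k y +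
        hessian (fun z => truncatedWave R k z - truncatedWave R p z) y j l) := by
  simp only [truncatedTensor, Matrix.smul_apply, Matrix.add_apply, smul_eq_mul]
  ring

theorem integrable_truncatedTensor {R : ℝ} (hR : 0 < R) (k p : ℝ) (j l : Fin 3) :
    Integrable fun y => truncatedTensor R k p y j l := by
  simp only [truncatedTensor_apply]
  exact (((integrable_truncatedWave hR k).const_mul _).add
    (hessian_truncatedWave_sub_regular k p hR j l).1).const_mul _

theorem memLp_two_truncatedTensor {R : ℝ} (hR : 0 < R) (k p : ℝ) (j l : Fin 3) :
    MemLp (fun y => truncatedTensor R k p y j l) 2 := by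
  simp only [truncatedTensor_apply]
  exact (((memLp_two_truncatedWave hR k).const_mul _).add
    (hessian_truncatedWave_sub_regular k p hR j l).2).const_mul _

/-- The symbol of the truncated tensor is `a I - b e eᵀ` with `e = ξ / |ξ|`, where
`a = k² A_k(s)` and `b = s² (A_k(s) - A_p(s))` for the Helmholtz symbols `A` at `s = 2 π |ξ|`. -/
theorem fourier_truncatedTensor {R : ℝ} (hR : 0 < R) (k p : ℝ) (j l : Fin 3) {ξ : R3}
    (hξ : ξ ≠ 0) :
    𝓕 (fun y => truncatedTensor R k p y j l) ξ =
      k ^ 2 * helmholtzSymbol R k (2 * Real.pi * ‖ξ‖) * (1 : Matrix (Fin 3) (Fin 3) ℂ) j l -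
      ((2 * Real.pi * ‖ξ‖ : ℝ) : ℂ) ^ 2 * (helmholtzSymbol R k (2 * Real.pi * ‖ξ‖) -
          helmholtzSymbol R p (2 * Real.pi * ‖ξ‖)) * ((ξ j / ‖ξ‖ : ℝ) * (ξ l / ‖ξ‖ : ℝ)) := by
  have i0 := integrable_truncatedWave hR k
  have i1 := integrable_truncatedWave hR p
  have i2 := (hessian_truncatedWave_sub_regular k p hR j l).1
  have hξ0 : (‖ξ‖ : ℂ) ≠ 0 := Complex.ofReal_ne_zero.2 (norm_ne_zero_iff.2 hξ)
  have hπ : (Real.pi : ℂ) ≠ 0 := Complex.ofReal_ne_zero.2 Real.pi_ne_zero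
  have hchar : ∀ {φ : R3 → ℂ}, Integrable φ →
      Integrable fun v => (𝐞 (-inner ℝ v ξ) : ℂ) * φ v := fun {φ} hφ => by
    simpa [Circle.smul_def] using (Real.fourierIntegral_convergent_iff ξ).2 hφ
  have hsub : 𝓕 (fun z => truncatedWave R k z - truncatedWave R p z) ξ =
      𝓕 (truncatedWave R k) ξ - 𝓕 (truncatedWave R p) ξ := by
    simp only [Real.fourier_eq, Circle.smul_def, smul_eq_mul, mul_sub]
    exact integral_sub (hchar i0) (hchar i1)
  have hlin : 𝓕 (fun y => truncatedTensor R k p y j l) ξ = 1 / (4 * (Real.pi : ℂ)) *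
      ((k : ℂ) ^ 2 * (1 : Matrix (Fin 3) (Fin 3) ℂ) j l * 𝓕 (truncatedWave R k) ξ +
        𝓕 (fun y => hessian (fun z => truncatedWave R k z - truncatedWave R p z) y j l) ξ) := by
    simp only [Real.fourier_eq, Circle.smul_def, smul_eq_mul, truncatedTensor_apply]
    rw [← integral_const_mul, ← integral_add ((hchar i0).const_mul _) (hchar i2),
      ← integral_const_mul]
    refine integral_congr_ae (Filter.Eventually.of_forall fun v => ?_)
    ring
  rw [hlin, fourier_hessian_truncatedWave_sub k p hR, hsub, fourier_truncatedWave hR k hξ,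
    fourier_truncatedWave hR p hξ]
  push_cast
  field_simp
  ring_nf
  rw [Complex.I_sq]
  ring

/-- A matrix `a I - b e eᵀ` with `e` a real unit vector acts as `a` on the complement of `e` and as
`a - b` on the line of `e`, so its norm is the larger of `‖a‖` and `‖a - b‖`. -/
theorem sum_norm_sq_rankOne_perturbation_le {a b : ℂ} {M : ℝ} {e : Fin 3 → ℝ}
    (he : ∑ j, e j ^ 2 = 1) (ha : ‖a‖ ≤ M) (hab : ‖a - b‖ ≤ M) (v : Fin 3 → ℂ) :
    ∑ j, ‖∑ l, (a * (1 : Matrix (Fin 3) (Fin 3) ℂ) j l - b * (e j * e l)) * v l‖ ^ 2 ≤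
      M ^ 2 * ∑ l, ‖v l‖ ^ 2 := by
  set c : ℂ := ∑ l, e l * v l with hc
  set w : Fin 3 → ℂ := fun j => v j - e j * c with hw
  have heC : ∑ j, (e j : ℂ) * e j = 1 := by
    have := congrArg (fun x : ℝ => (x : ℂ)) he
    push_cast at this
    simpa [pow_two] using this
  have horth : ∑ j, (e j : ℂ) * w j = 0 := by
    simp only [hw, mul_sub, Finset.sum_sub_distrib, ← mul_assoc, ← Finset.sum_mul, heC]
    simp [hc]
  -- Pythagoras for the splitting into the parts orthogonal and parallel to `e`
  have pyth : ∀ x y : ℂ, ∑ j, ‖x * w j + y * (e j * c)‖ ^ 2 =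
      ‖x‖ ^ 2 * ∑ j, ‖w j‖ ^ 2 + ‖y‖ ^ 2 * ‖c‖ ^ 2 := by
    intro x y
    have hcross : ∑ j, (x * w j * (starRingEnd ℂ) (y * (e j * c))).re = 0 := by
      rw [← Complex.re_sum]
      have : ∑ j, x * w j * (starRingEnd ℂ) (y * (e j * c)) =
          x * (starRingEnd ℂ) (y * c) * ∑ j, (e j : ℂ) * w j := by
        rw [Finset.mul_sum]
        refine Finset.sum_congr rfl fun j _ => ?_
        simp only [map_mul, Complex.conj_ofReal]
        ring
      rw [this, horth, mul_zero, Complex.zero_re]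
    have hpar : ∑ j, Complex.normSq (y * (e j * c)) = Complex.normSq y * Complex.normSq c := by
      simp only [map_mul, Complex.normSq_ofReal]
      rw [← Finset.mul_sum, ← Finset.sum_mul]
      simp only [← pow_two, he, one_mul]
    simp only [Complex.sq_norm, Complex.normSq_add, Finset.sum_add_distrib, ← Finset.mul_sum,
      hcross, hpar, mul_zero, add_zero]
    simp only [map_mul, Finset.mul_sum]
  have hv : ∑ l, ‖v l‖ ^ 2 = ∑ j, ‖w j‖ ^ 2 + ‖c‖ ^ 2 := by
    have := pyth 1 1
    simpa [hw] using this
  have hrow : ∀ j, ∑ l, (a * (1 : Matrix (Fin 3) (Fin 3) ℂ) j l - b * (e j * e l)) * v l =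
      a * w j + (a - b) * (e j * c) := by
    intro j
    have h1 : ∑ l, (1 : Matrix (Fin 3) (Fin 3) ℂ) j l * v l = v j := by
      simp [Matrix.one_apply]
    calc _ = a * ∑ l, (1 : Matrix (Fin 3) (Fin 3) ℂ) j l * v l - b * e j * ∑ l, e l * v l := by
          rw [Finset.mul_sum, Finset.mul_sum, ← Finset.sum_sub_distrib]
          exact Finset.sum_congr rfl fun l _ => by ring
      _ = _ := by
          rw [h1, ← hc]
          simp only [hw]
          ring
  simp only [hrow]
  rw [pyth, hv, mul_add]
  gcongr

/-- The transversal eigenvalue is the Helmholtz symbol for `k`, the longitudinal one is bounded by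
`norm_longitudinal_symbol_le`. -/
theorem symbol_truncatedTensor_le {R k p : ℝ} (hR : 0 < R) (hp : 0 < p) (hpk : p ≤ k) {ξ : R3}
    (hξ : ξ ≠ 0) (v : Fin 3 → ℂ) :
    ∑ j, ‖∑ l, 𝓕 (fun y => truncatedTensor R k p y j l) ξ * v l‖ ^ 2 ≤
      (8 / 3 + 8 * R * k) ^ 2 * ∑ l, ‖v l‖ ^ 2 := by
  have hk : 0 < k := hp.trans_le hpk
  have hs : 0 < 2 * Real.pi * ‖ξ‖ := by have := norm_pos_iff.2 hξ; positivity
  simp only [fourier_truncatedTensor hR k p _ _ hξ]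
  refine sum_norm_sq_rankOne_perturbation_le ?_ ?_ (norm_longitudinal_symbol_le hR hp hpk hs) v
  · simp only [div_pow, ← Finset.sum_div]
    rw [← EuclideanSpace.real_norm_sq_eq, div_self]
    exact pow_ne_zero 2 (norm_ne_zero_iff.2 hξ)
  · rw [norm_mul, norm_pow, Complex.norm_real, Real.norm_of_nonneg hk.le]
    have := sq_mul_norm_helmholtzSymbol_le hR hk hs
    nlinarith [mul_pos hR hk]

theorem integral_norm_sq_truncatedTensor_convolution_le {R k p : ℝ} (hR : 0 < R) (hp : 0 < p)
    (hpk : p ≤ k) {f : R3 → C3} (hf : Integrable f) (hf2 : MemLp f 2) :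
    ∫ x, ‖tensorConvolution (truncatedTensor R k p) f x‖ ^ 2 ≤
      (8 / 3 + 8 * R * k) ^ 2 * ∫ x, ‖f x‖ ^ 2 := by
  refine integral_norm_sq_tensorConvolution_le (integrable_truncatedTensor hR k p)
    (memLp_two_truncatedTensor hR k p) hf hf2 ?_
  have hne : ∀ᵐ ξ : R3, ξ ≠ 0 := by simp [ae_iff]
  filter_upwards [hne] with ξ hξ v
  exact symbol_truncatedTensor_le hR hp hpk hξ v

end Kernel

/-! ### Comparison with the Green's tensor -/

theorem shearSpeed_pos {ρ μ : ℝ} (hρ : 0 < ρ) (hμ : 0 < μ) : 0 < shearSpeed ρ μ :=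
  Real.sqrt_pos.2 (div_pos hμ hρ)

theorem shearSpeed_le_pressureSpeed {ρ μ lam : ℝ} (hρ : 0 < ρ) (hμ : 0 < μ) (hlam : 0 ≤ lam) :
    shearSpeed ρ μ ≤ pressureSpeed ρ μ lam := by
  unfold shearSpeed pressureSpeed
  gcongr
  linarith

theorem pressureWavenumber_pos {ρ μ lam ω : ℝ} (hρ : 0 < ρ) (hμ : 0 < μ) (hlam : 0 ≤ lam)
    (hω : 0 < ω) : 0 < pressureWavenumber ρ μ lam ω :=
  div_pos hω ((shearSpeed_pos hρ hμ).trans_le (shearSpeed_le_pressureSpeed hρ hμ hlam))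

theorem pressureWavenumber_le_shearWavenumber {ρ μ lam ω : ℝ} (hρ : 0 < ρ) (hμ : 0 < μ)
    (hlam : 0 ≤ lam) (hω : 0 < ω) : pressureWavenumber ρ μ lam ω ≤ shearWavenumber ρ μ ω :=
  div_le_div_of_nonneg_left hω.le (shearSpeed_pos hρ hμ) (shearSpeed_le_pressureSpeed hρ hμ hlam)

theorem truncatedTensor_eq_greenTensor {ρ μ ω R : ℝ} (hρ : 0 < ρ) (hμ : 0 < μ) (hω : 0 < ω)
    (hR : 0 < R) (lam : ℝ) {y : R3} (hy : ‖y‖ < R) (j l : Fin 3) :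
    truncatedTensor R (shearWavenumber ρ μ ω) (pressureWavenumber ρ μ lam ω) y j l =
      (ω : ℂ) ^ 2 * greenTensor ρ μ lam ω y j l := by
  have hθ : (shearSpeed ρ μ : ℂ) ≠ 0 := Complex.ofReal_ne_zero.2 (shearSpeed_pos hρ hμ).ne'
  have hω' : (ω : ℂ) ≠ 0 := Complex.ofReal_ne_zero.2 hω.ne'
  have hk : (shearWavenumber ρ μ ω : ℂ) = ω / shearSpeed ρ μ := by
    rw [shearWavenumber]; push_cast; rfl
  have hev : ∀ z : R3, ‖z‖ < R → (fun z => truncatedWave R (shearWavenumber ρ μ ω) z -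
      truncatedWave R (pressureWavenumber ρ μ lam ω) z) =ᶠ[nhds z]
      fun z => sphericalWave (shearWavenumber ρ μ ω) z -
        sphericalWave (pressureWavenumber ρ μ lam ω) z := by
    intro z hz
    filter_upwards [(isOpen_lt continuous_norm continuous_const).mem_nhds hz] with w hw
    rw [truncatedWave_eq_sphericalWave hR _ (le_of_lt hw),
      truncatedWave_eq_sphericalWave hR _ (le_of_lt hw)]
  have hpart : partialDeriv l (fun z => truncatedWave R (shearWavenumber ρ μ ω) z -
      truncatedWave R (pressureWavenumber ρ μ lam ω) z) =ᶠ[nhds y]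
      partialDeriv l fun z => sphericalWave (shearWavenumber ρ μ ω) z -
        sphericalWave (pressureWavenumber ρ μ lam ω) z := by
    filter_upwards [(isOpen_lt continuous_norm continuous_const).mem_nhds hy] with w hw
    rw [partialDeriv, partialDeriv, (hev w hw).fderiv_eq]
  have hhess : hessian (fun z => truncatedWave R (shearWavenumber ρ μ ω) z -
      truncatedWave R (pressureWavenumber ρ μ lam ω) z) y j l =
      hessian (fun z => sphericalWave (shearWavenumber ρ μ ω) z -
        sphericalWave (pressureWavenumber ρ μ lam ω) z) y j l := by
    simp only [hessian, Matrix.of_apply]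
    rw [partialDeriv, hpart.fderiv_eq, ← partialDeriv]
  rw [truncatedTensor_apply, hhess, truncatedWave_eq_sphericalWave hR _ hy.le]
  simp only [greenTensor, Matrix.smul_apply, Matrix.add_apply, smul_eq_mul, hk]
  field_simp

section Support

variable {f : R3 → C3} {ℓ : ℝ}

theorem integrable_of_memLp_two_of_support (hf : MemLp f 2 volume)
    (hsupp : ∀ᵐ x : R3, x ∉ ball 0 ℓ → f x = 0) : Integrable f := by
  have : IsFiniteMeasure ((volume : Measure R3).restrict (ball 0 ℓ)) :=
    ⟨by rw [Measure.restrict_apply_univ]; exact measure_ball_lt_top⟩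
  have h : IntegrableOn f (ball 0 ℓ) := (hf.restrict (ball 0 ℓ)).integrable (by norm_num)
  rw [← integrable_indicator_iff measurableSet_ball] at h
  refine h.congr ?_
  filter_upwards [hsupp] with x hx
  by_cases hxb : x ∈ ball 0 ℓ
  · rw [Set.indicator_of_mem hxb]
  · rw [Set.indicator_of_notMem hxb, hx hxb]

theorem integral_norm_sq_eq_of_support (hsupp : ∀ᵐ x : R3, x ∉ ball 0 ℓ → f x = 0) :
    ∫ x in ball 0 ℓ, ‖f x‖ ^ 2 = ∫ x, ‖f x‖ ^ 2 := by
  rw [← integral_indicator measurableSet_ball]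
  refine integral_congr_ae ?_
  filter_upwards [hsupp] with x hx
  by_cases hxb : x ∈ ball 0 ℓ
  · rw [Set.indicator_of_mem hxb]
  · rw [Set.indicator_of_notMem hxb, hx hxb]
    simp

variable {ρ μ ω R : ℝ}

/-- The integrands of the convolutions with `ω² G` and with its truncation agree at points `x` with
`|x| + ℓ ≤ R`: on the support of `t ↦ f (x - t)` one has `|t| < |x| + ℓ`. -/
theorem truncatedTensor_mul_ae_eq (hρ : 0 < ρ) (hμ : 0 < μ) (hω : 0 < ω) (hR : 0 < R) (lam : ℝ)
    (hsupp : ∀ᵐ x : R3, x ∉ ball 0 ℓ → f x = 0) {x : R3} (hx : ‖x‖ + ℓ ≤ R) (j l : Fin 3) :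
    (fun t => truncatedTensor R (shearWavenumber ρ μ ω) (pressureWavenumber ρ μ lam ω) t j l *
      f (x - t) l) =ᵐ[volume] fun t => (ω : ℂ) ^ 2 * (greenTensor ρ μ lam ω t j l * f (x - t) l) := by
  have hq : ∀ᵐ t : R3, x - t ∉ ball 0 ℓ → f (x - t) = 0 :=
    (Measure.measurePreserving_sub_left volume x).quasiMeasurePreserving.ae hsupp
  filter_upwards [hq] with t ht
  by_cases hb : x - t ∈ ball 0 ℓ
  · have h1 : ‖x - t‖ < ℓ := by simpa using hb
    have h2 : ‖t‖ < R := by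
      have := norm_sub_le x (x - t)
      rw [sub_sub_cancel] at this
      linarith
    rw [truncatedTensor_eq_greenTensor hρ hμ hω hR lam h2]
    ring
  · simp [ht hb]

theorem tensorConvolutionExists_greenTensor (hρ : 0 < ρ) (hμ : 0 < μ) (hω : 0 < ω) (hℓ : 0 < ℓ)
    (lam : ℝ) (hf : MemLp f 2 volume) (hsupp : ∀ᵐ x : R3, x ∉ ball 0 ℓ → f x = 0) :
    TensorConvolutionExists (greenTensor ρ μ lam ω) f := by
  intro j l x
  have hR : 0 < ‖x‖ + ℓ := by positivity
  have hω' : (ω : ℂ) ^ 2 ≠ 0 := pow_ne_zero 2 (Complex.ofReal_ne_zero.2 hω.ne')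
  have h1 : Integrable fun t => truncatedTensor (‖x‖ + ℓ) (shearWavenumber ρ μ ω)
      (pressureWavenumber ρ μ lam ω) t j l * f (x - t) l :=
    (memLp_two_truncatedTensor hR _ _ j l).integrable_mul
      ((memLp_piLp_iff.1 hf l).comp_measurePreserving (Measure.measurePreserving_sub_left volume x))
  have h2 := (h1.congr
    (truncatedTensor_mul_ae_eq hρ hμ hω hR lam hsupp le_rfl j l)).const_mul ((ω : ℂ) ^ 2)⁻¹
  simp only [inv_mul_cancel_left₀ hω'] at h2
  exact h2

theorem tensorConvolution_truncatedTensor_eq (hρ : 0 < ρ) (hμ : 0 < μ) (hω : 0 < ω) (hR : 0 < R)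
    (lam : ℝ) (hsupp : ∀ᵐ x : R3, x ∉ ball 0 ℓ → f x = 0) {x : R3} (hx : ‖x‖ + ℓ ≤ R) :
    tensorConvolution (truncatedTensor R (shearWavenumber ρ μ ω)
        (pressureWavenumber ρ μ lam ω)) f x =
      ((ω : ℂ) ^ 2) • tensorConvolution (greenTensor ρ μ lam ω) f x := by
  ext j
  simp only [tensorConvolution, PiLp.smul_apply, smul_eq_mul, Finset.mul_sum]
  refine Finset.sum_congr rfl fun l _ => ?_
  simp only [convolution, ContinuousLinearMap.mul_apply']
  rw [← integral_const_mul]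
  exact integral_congr_ae (truncatedTensor_mul_ae_eq hρ hμ hω hR lam hsupp hx j l)

end Support

theorem memLp_and_weightedNorm_greenTensor_convolution_le {ρ μ lam ω ℓ : ℝ} (hρ : 0 < ρ)
    (hμ : 0 < μ) (hlam : 0 ≤ lam) (hω : 0 < ω) (hℓ : 0 < ℓ) {f : R3 → C3} (hf : MemLp f 2 volume)
    (hsupp : ∀ᵐ x : R3, x ∉ ball 0 ℓ → f x = 0) :
    MemLp (tensorConvolution (greenTensor ρ μ lam ω) f) 2 (volume.restrict (ball 0 ℓ)) ∧
    ω ^ 2 * weightedNorm (fun _ => ρ) (ball 0 ℓ)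
        (tensorConvolution (greenTensor ρ μ lam ω) f) ≤
      (4 + 17 * (shearWavenumber ρ μ ω * ℓ)) * weightedNorm (fun _ => ρ) (ball 0 ℓ) f := by
  have hfi := integrable_of_memLp_two_of_support hf hsupp
  have hp := pressureWavenumber_pos hρ hμ hlam hω
  have hpk := pressureWavenumber_le_shearWavenumber hρ hμ hlam hω
  have hk := hp.trans_le hpk
  set k := shearWavenumber ρ μ ω with hk_def
  set p := pressureWavenumber ρ μ lam ω with hp_def
  set u := tensorConvolution (greenTensor ρ μ lam ω) f with hu
  -- For `x` and `y` in the ball of radius `ℓ` the difference `x - y` has norm below `2 ℓ`.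
  have hR : 0 < 2 * ℓ := by positivity
  set w := tensorConvolution (truncatedTensor (2 * ℓ) k p) f with hw
  have hw2 : MemLp w 2 := memLp_two_tensorConvolution (integrable_truncatedTensor hR k p)
    (memLp_two_truncatedTensor hR k p) hfi hf
  have hwu : ∀ x ∈ ball (0 : R3) ℓ, w x = ((ω : ℂ) ^ 2) • u x := fun x hx =>
    tensorConvolution_truncatedTensor_eq hρ hμ hω hR lam hsupp
      (by have : ‖x‖ < ℓ := by simpa using hx
          linarith)
  have hω' : (ω : ℂ) ^ 2 ≠ 0 := pow_ne_zero 2 (Complex.ofReal_ne_zero.2 hω.ne')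
  refine ⟨?_, ?_⟩
  · refine ((hw2.restrict (ball 0 ℓ)).const_smul ((ω : ℂ) ^ 2)⁻¹).ae_eq ?_
    filter_upwards [ae_restrict_mem measurableSet_ball] with x hx
    rw [Pi.smul_apply, hwu x hx, inv_smul_smul₀ hω']
  · have hM : 0 ≤ 4 + 17 * (k * ℓ) := by positivity
    have hbound : ω ^ 4 * ∫ x in ball 0 ℓ, ‖u x‖ ^ 2 ≤
        (4 + 17 * (k * ℓ)) ^ 2 * ∫ x in ball 0 ℓ, ‖f x‖ ^ 2 := by
      calc ω ^ 4 * ∫ x in ball 0 ℓ, ‖u x‖ ^ 2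
          = ∫ x in ball 0 ℓ, ‖w x‖ ^ 2 := by
            rw [← integral_const_mul]
            refine setIntegral_congr_fun measurableSet_ball fun x hx => ?_
            simp only [hwu x hx, norm_smul, norm_pow, Complex.norm_real,
              Real.norm_of_nonneg hω.le]
            ring
        _ ≤ ∫ x, ‖w x‖ ^ 2 := setIntegral_le_integral
            ((memLp_two_iff_integrable_sq_norm hw2.1).1 hw2)
            (Filter.Eventually.of_forall fun x => by positivity)
        _ ≤ (8 / 3 + 8 * (2 * ℓ) * k) ^ 2 * ∫ x, ‖f x‖ ^ 2 :=
            integral_norm_sq_truncatedTensor_convolution_le hR hp hpk hfi hf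
        _ ≤ (4 + 17 * (k * ℓ)) ^ 2 * ∫ x, ‖f x‖ ^ 2 := by
            gcongr ?_ ^ 2 * _
            nlinarith [mul_pos hk hℓ]
        _ = _ := by rw [integral_norm_sq_eq_of_support hsupp]
    unfold weightedNorm
    rw [integral_const_mul, integral_const_mul]
    refine (abs_le_of_sq_le_sq' ?_ ?_).2
    · rw [mul_pow, mul_pow, Real.sq_sqrt (by positivity), Real.sq_sqrt (by positivity)]
      nlinarith [mul_le_mul_of_nonneg_left hbound hρ.le]
    · positivity

end Elastodynamics

end

theorem mainTheorem9
    (ρ μ lam ω ℓ : ℝ) (hρ : 0 < ρ) (hμ : 0 < μ) (hlam : 0 ≤ lam) (hω : 0 < ω) (hℓ : 0 < ℓ)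
    (f : Elastodynamics.R3 → Elastodynamics.C3)
    (hf : MemLp f 2 volume)
    (hsupp : ∀ᵐ x ∂(volume : Measure Elastodynamics.R3), x ∉ ball 0 ℓ → f x = 0) :
    Elastodynamics.TensorConvolutionExists (Elastodynamics.greenTensor ρ μ lam ω) f ∧
    MemLp (Elastodynamics.tensorConvolution (Elastodynamics.greenTensor ρ μ lam ω) f) 2
      (volume.restrict (ball 0 ℓ)) ∧
    ω ^ 2 * Elastodynamics.weightedNorm (fun _ => ρ) (ball 0 ℓ)
        (Elastodynamics.tensorConvolution (Elastodynamics.greenTensor ρ μ lam ω) f) ≤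
      (4 + 17 * (Elastodynamics.shearWavenumber ρ μ ω * ℓ)) *
        Elastodynamics.weightedNorm (fun _ => ρ) (ball 0 ℓ) f := by
  exact ⟨Elastodynamics.tensorConvolutionExists_greenTensor hρ hμ hω hℓ lam hf hsupp,
    Elastodynamics.memLp_and_weightedNorm_greenTensor_convolution_le hρ hμ hlam hω hℓ hf hsupp⟩
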